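/- \textbf{Setting.} Let $U$ be a compact metric space, $Y\subset\mathbb R^m$ and $Z\subset\mathbb R^n$ compact sets, $C>0$, and let $f:U\times\mathbb R^m\times\mathbb R^n\to\mathbb R^m$, $g:U\times\mathbb R^m\times\mathbb R^n\to\mathbb R^n$ be continuous and satisfy Lipschitz conditions in $(y,z)$ on $Y\times Z$, uniformly in $u\in U$; let $L_f>0$ be a Lipschitz constant of $f$, i.e. $\|f(u,y,z)-f(u,y',z')\|\le L_f(\|y-y'\|+\|z-z'\|)$. For $\epsilon\in(0,1)$ consider the singularly perturbed (SP) system $$\epsilon y'(t)=f(u(t),y(t),z(t)),\qquad z'(t)=g(u(t),y(t),z(t)),\qquad (y(0),z(0))=(y_0,z_0),\qquad t\ge 0,$$ whose controls are measurable functions $u:[0,\infty)\to U$ (solutions are locally absolutely continuous and satisfy the equations almost everywhere); assume that all its solutions satisfy $(y(t),z(t))\in Y\times Z$ for all $t\ge0$. For fixed $z\in Z$, a pair $(u(\cdot),y(\cdot))$ is \emph{admissible for the associated system} if $u:[0,\infty)\to U$ is measurable, $y$ is locally absolutely continuous, $y(\tau)\in Y$ for all $\tau\ge0$, and $y'(\tau)=f(u(\tau),y(\tau),z)$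 for almost all $\tau\ge 0$. For $K$ compact, $\mathcal P(K)$ is the set of Borel probability measures on $K$ with the weak$^*$ topology, metrized by $\rho(\gamma',\gamma'')=\sum_{l\ge1}2^{-l}\bigl|\int q_l\,d\gamma'-\int q_l\,d\gamma''\bigr|$, where $(q_l)$ is a sequence of Lipschitz functions that is dense in the unit ball of $C(K)$. \textbf{ACG family.} For each $z\in Z$ let $(u_z(\cdot),y_z(\cdot))$ be admissible for the associated system and let $\mu(du,dy|z)\in\mathcal P(U\times Y)$ be such that, for every continuous $q:U\times Y\times Z\to\mathbb R$, the function $\tilde q_\mu(z)=\int_{U\times Y}q(u,y,z)\,\mu(du,dy|z)$ is measurable on $Z$ and $$\Bigl|\frac1S\int_0^Sq(u_z(\tau),y_z(\tau),z)\,d\tau-\tilde q_\mu(z)\Bigr|\le\phi_q(S)\quad\forall z\in Z,\ S>0,\qquad \lim_{S\to\infty}\phi_q(S)=0.$$ With $\tilde g_\mu(z)=\int g(u,y,z)\,\mu(du,dy|z)$, assume that $z'(t)=\tilde g_\mu(z(t))$, $z(0)=z_0$, has a unique solution $z(\cdot)$ on $[0,\infty)$ with values in $Z$; the family $(u_z(\cdot),y_z(\cdot))$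 is then called average control generating (ACG). \textbf{Uniform attainability.} Assume that for all $y\in Y$, $z\in Z$ there is a pair $(u_{y,z}(\cdot),y_{y,z}(\cdot))$, admissible for the associated system, with $y_{y,z}(0)=y$, such that the occupational measures $\mu^{y,z,S}(Q)=\frac1S\int_0^S1_Q(u_{y,z}(\tau),y_{y,z}(\tau))\,d\tau$ satisfy $\rho(\mu^{y,z,S},\mu(du,dy|z))\le\phi(S)$ for all $y\in Y$, $z\in Z$, $S>0$, where $\lim_{S\to\infty}\phi(S)=0$. \textbf{Weak piecewise Lipschitz continuity near $z(\cdot)$.} A function $h$ on $Z$ is called piecewise Lipschitz continuous near $z(\cdot)$ on $[0,T]$, with exceptional times $\bar t_1,\dots,\bar t_k\in[0,T]$ ($k\ge0$ finite) and radii $a_t>0$ ($t\in[0,T]\setminus\{\bar t_i\}$), if there is a constant $L$ such that, for all these $t$, $h$ is Lipschitz with constant $L$ on $(z(t)+a_tB)\cap Z$ ($B$ being the open unit ball), and if $r_\delta=\inf\{a_t:\ t\in[0,T]\setminus\bigcup_i(\bar t_i-\delta,\bar t_i+\delta)\}$ is a positive and right-continuous function of $\delta$ for all sufficiently small $\delta>0$.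 Assume that for every $T>0$ the function $\tilde g_\mu$ has this property, with some exceptional times $\bar t_i$ and radii $a_t$ (depending on $T$), and that for every $T>0$ and every Lipschitz continuous $q:U\times Y\times Z\to\mathbb R$ the function $\tilde q_\mu$ has this property with some exceptional times and radii (depending on $T$ and $q$). \textbf{The control.} Let $\Delta(\epsilon)=\frac{\epsilon}{2L_f}\ln\frac1\epsilon$ and $t_l=l\Delta(\epsilon)$, $l=0,1,\dots$. For $\epsilon\in(0,1)$ let $u_\epsilon(\cdot)$ be the control constructed successively on the intervals $[t_l,t_{l+1})$ by $$u_\epsilon(t)=u_{y_\epsilon(t_l),z_\epsilon(t_l)}\Bigl(\frac{t-t_l}\epsilon\Bigr),\qquad t\in[t_l,t_{l+1}),\ l=0,1,\dots,$$ $(y_\epsilon(\cdot),z_\epsilon(\cdot))$ being the corresponding solution of the SP system on $[0,\infty)$. \textbf{Tube condition.} Assume that for every $T>0$ there is $\bar\delta_T(\epsilon)>0$ with $\lim_{\epsilon\to0}\bar\delta_T(\epsilon)=0$ such that, for all sufficiently small $\epsilon$, $$z_\epsilon(t)\in z(t)+a_tB\qquad\forall t\in[0,T]\setminus\bigcup_{i=1}^k(\bar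 t_i-\bar\delta_T(\epsilon),\bar t_i+\bar\delta_T(\epsilon)),$$ where $\bar t_i$ and $a_t$ are the exceptional times and radii of $\tilde g_\mu$ on $[0,T]$. \textbf{Conclusion.} For every $T>0$ there is $\beta_T(\epsilon)$ with $\lim_{\epsilon\to0}\beta_T(\epsilon)=0$ and $$\max_{t\in[0,T]}\|z_\epsilon(t)-z(t)\|\le\beta_T(\epsilon).$$ Moreover, the discounted occupational measures $\gamma^\epsilon_{di}(Q)=C\int_0^\infty e^{-Ct}1_Q(u_\epsilon(t),y_\epsilon(t),z_\epsilon(t))\,dt$ converge weakly$^*$ in $\mathcal P(U\times Y\times Z)$, as $\epsilon\to0$, to $\gamma(du,dy,dz)=\mu(du,dy|z)\,\nu_{di}(dz)$, where $\nu_{di}(Q)=C\int_0^\infty e^{-Ct}1_Q(z(t))\,dt$; that is, $\lim_{\epsilon\to0}\rho(\gamma^\epsilon_{di},\gamma)=0$. -/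

import Mathlib

open MeasureTheory Filter Set
open scoped Topology NNReal ENNReal

noncomputable section

namespace SPControl

/-- `ℝᵏ` with its Euclidean norm. -/
abbrev E (k : ℕ) : Type := EuclideanSpace ℝ (Fin k)

/-! ### Measures, the metric `ρ`, occupational measures -/

section Measures

variable {W : Type*} [MeasurableSpace W]

/-- Occupational measure generated by `w` on `[0, S]` (for `S > 0`): the normalized push-forward
of Lebesgue measure on `[0, S]`. -/
def occMeasure (w : ℝ → W) (S : ℝ) : Measure W :=
  (ENNReal.ofReal S)⁻¹ • (volume.restrict (Icc 0 S)).map w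

/-- Discounted occupational measure generated by `w` on `[0, ∞)`: the push-forward of
`C e^{-C t} dt`. -/
def discOccMeasure (C : ℝ) (w : ℝ → W) : Measure W :=
  ((volume.restrict (Ici 0)).withDensity
    (fun t => ENNReal.ofReal (C * Real.exp (-C * t)))).map w

/-- `ν` belongs to `𝒫(K)`, seen as a measure on the ambient space. -/
def IsProbOn (K : Set W) (ν : Measure W) : Prop :=
  IsProbabilityMeasure ν ∧ ν Kᶜ = 0

/-- `ρ(ν₁, ν₂) = ∑_{l ≥ 1} 2^{-l} |∫ q_l dν₁ - ∫ q_l dν₂|` (the sequence is indexed from `0`). -/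
def rho (q : ℕ → W → ℝ) (ν₁ ν₂ : Measure W) : ℝ :=
  ∑' l : ℕ, (1 / 2 : ℝ) ^ (l + 1) * |(∫ w, q l w ∂ν₁) - ∫ w, q l w ∂ν₂|

end Measures

/-- A sequence of Lipschitz functions on `K` which is dense in the unit ball of `C(K)`. -/
structure IsTestSequence {W : Type*} [PseudoMetricSpace W] (K : Set W) (q : ℕ → W → ℝ) :
    Prop where
  lipschitz : ∀ l, ∃ L : ℝ≥0, LipschitzOnWith L (q l) K
  unit_ball : ∀ l, ∀ w ∈ K, |q l w| ≤ 1
  dense : ∀ φ : W → ℝ, ContinuousOn φ K → (∀ w ∈ K, |φ w| ≤ 1) →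
    ∀ η : ℝ, 0 < η → ∃ l, ∀ w ∈ K, |q l w - φ w| < η

/-- Weak* convergence in `𝒫(K)`, as `ε → 0⁺`, of `ν ε` to `ν₀`. -/
def WeakStarTendsto {W : Type*} [TopologicalSpace W] [MeasurableSpace W] (K : Set W)
    (ν : ℝ → Measure W) (ν₀ : Measure W) : Prop :=
  ∀ φ : W → ℝ, ContinuousOn φ K →
    Tendsto (fun ε => ∫ w, φ w ∂(ν ε)) (𝓝[>] 0) (𝓝 (∫ w, φ w ∂ν₀))

/-! ### The systems -/

/-- Absolute continuity on every interval `[0, S]`. -/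
def LocallyAC {F : Type*} [PseudoMetricSpace F] (x : ℝ → F) : Prop :=
  ∀ S : ℝ, 0 ≤ S → AbsolutelyContinuousOnInterval x 0 S

/-- `L` is a Lipschitz constant in `(y, z)` on `Y × Z`, uniformly in `u`. -/
def LipschitzInState {U : Type*} {m n k : ℕ} (Y : Set (E m)) (Z : Set (E n))
    (h : U → E m → E n → E k) (L : ℝ) : Prop :=
  ∀ u, ∀ y ∈ Y, ∀ y' ∈ Y, ∀ z ∈ Z, ∀ z' ∈ Z,
    ‖h u y z - h u y' z'‖ ≤ L * (‖y - y'‖ + ‖z - z'‖)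

section Systems

variable {U : Type*} [MeasurableSpace U] {m n : ℕ}

/-- A control on `[0, ∞)`: a (Lebesgue) measurable `U`-valued function. -/
def IsControl (u : ℝ → U) : Prop := AEMeasurable u (volume.restrict (Ici 0))

/-- `(y, z)` solves on `[0, ∞)` the singularly perturbed system
`ε y' = f(u, y, z)`, `z' = g(u, y, z)`, `(y(0), z(0)) = (y₀, z₀)` with the control `u`. -/
structure IsSPSolution (f : U → E m → E n → E m) (g : U → E m → E n → E n) (y₀ : E m) (z₀ : E n)
    (ε : ℝ) (u : ℝ → U) (y : ℝ → E m) (z : ℝ → E n) : Prop where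
  control : IsControl u
  ac_fast : LocallyAC y
  ac_slow : LocallyAC z
  init_fast : y 0 = y₀
  init_slow : z 0 = z₀
  fast : ∀ᵐ t ∂(volume.restrict (Ici (0 : ℝ))), HasDerivAt y (ε⁻¹ • f (u t) (y t) (z t)) t
  slow : ∀ᵐ t ∂(volume.restrict (Ici (0 : ℝ))), HasDerivAt z (g (u t) (y t) (z t)) t

/-- `(u, y)` is an admissible pair of the associated system `y'(τ) = f(u(τ), y(τ), z)`,
`z = const`, viable in `Y`. -/
structure IsAdmissiblePair (f : U → E m → E n → E m) (Y : Set (E m)) (z : E n)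
    (u : ℝ → U) (y : ℝ → E m) : Prop where
  control : IsControl u
  ac : LocallyAC y
  mem : ∀ τ : ℝ, 0 ≤ τ → y τ ∈ Y
  ode : ∀ᵐ τ ∂(volume.restrict (Ici (0 : ℝ))), HasDerivAt y (f (u τ) (y τ) z) τ

/-- `h̃_μ(z) = ∫ h(u, y, z) μ(du, dy | z)`. -/
def avg {F : Type*} [NormedAddCommGroup F] [NormedSpace ℝ F] (μ : E n → Measure (U × E m))
    (h : U → E m → E n → F) (z : E n) : F :=
  ∫ p, h p.1 p.2 z ∂(μ z)

/-- `z` solves on `[0, ∞)`, within `Z`, the equation `z'(t) = g̃_μ(z(t))`, `z(0) = z₀`. -/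
structure IsAveragedSolution (g : U → E m → E n → E n) (μ : E n → Measure (U × E m))
    (Z : Set (E n)) (z₀ : E n) (z : ℝ → E n) : Prop where
  ac : LocallyAC z
  mem : ∀ t : ℝ, 0 ≤ t → z t ∈ Z
  init : z 0 = z₀
  ode : ∀ᵐ t ∂(volume.restrict (Ici (0 : ℝ))), HasDerivAt z (avg μ g (z t)) t

end Systems

/-! ### ACG families -/

section ACG

variable {U : Type*} [MetricSpace U] [MeasurableSpace U] {m n : ℕ}

/-- `(u_z, y_z)`, `z ∈ Z`, is an average control generating family, `μ(du, dy | z)` is the family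
of occupational measures generated by it on `[0, ∞)`, and `z(·)` is the solution of the averaged
equation. -/
structure IsACGFamily (f : U → E m → E n → E m) (g : U → E m → E n → E n)
    (Y : Set (E m)) (Z : Set (E n)) (z₀ : E n)
    (uz : E n → ℝ → U) (yz : E n → ℝ → E m) (μ : E n → Measure (U × E m)) (z : ℝ → E n) :
    Prop where
  admissible : ∀ ζ ∈ Z, IsAdmissiblePair f Y ζ (uz ζ) (yz ζ)
  prob : ∀ ζ ∈ Z, IsProbOn (univ ×ˢ Y) (μ ζ)
  measurable : ∀ q : U → E m → E n → ℝ,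
    ContinuousOn (fun p : U × E m × E n => q p.1 p.2.1 p.2.2) (univ ×ˢ Y ×ˢ Z) →
    Measurable (fun ζ : Z => avg μ q (ζ : E n))
  occupational : ∀ q : U → E m → E n → ℝ,
    ContinuousOn (fun p : U × E m × E n => q p.1 p.2.1 p.2.2) (univ ×ˢ Y ×ˢ Z) →
    ∃ φ : ℝ → ℝ, Tendsto φ atTop (𝓝 0) ∧ ∀ S : ℝ, 0 < S → ∀ ζ ∈ Z,
      |S⁻¹ * (∫ τ in (0 : ℝ)..S, q (uz ζ τ) (yz ζ τ) ζ) - avg μ q ζ| ≤ φ S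
  solution : IsAveragedSolution g μ Z z₀ z
  unique : ∀ z' : ℝ → E n, IsAveragedSolution g μ Z z₀ z' → ∀ t : ℝ, 0 ≤ t → z' t = z t

/-- The family `μ(du, dy | ·)` is uniformly attainable by the associated system, through the
steering pairs `(us y ζ, ys y ζ)` starting at `y`. -/
structure IsUniformlyAttainable (f : U → E m → E n → E m) (Y : Set (E m)) (Z : Set (E n))
    (q : ℕ → U × E m → ℝ) (μ : E n → Measure (U × E m))
    (us : E m → E n → ℝ → U) (ys : E m → E n → ℝ → E m) : Prop where
  admissible : ∀ y ∈ Y, ∀ ζ ∈ Z, IsAdmissiblePair f Y ζ (us y ζ) (ys y ζ)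
  init : ∀ y ∈ Y, ∀ ζ ∈ Z, ys y ζ 0 = y
  uniform : ∃ φ : ℝ → ℝ, Tendsto φ atTop (𝓝 0) ∧ ∀ S : ℝ, 0 < S → ∀ y ∈ Y, ∀ ζ ∈ Z,
    rho q (occMeasure (fun τ => (us y ζ τ, ys y ζ τ)) S) (μ ζ) ≤ φ S

/-- `r_δ = inf { a_t : t ∈ [0, T], t ∉ ⋃ᵢ (t̄ᵢ - δ, t̄ᵢ + δ) }`. -/
def tubeRadius (T : ℝ) (tb : Finset ℝ) (a : ℝ → ℝ) (δ : ℝ) : ℝ :=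
  sInf (a '' {t | t ∈ Icc 0 T ∧ ∀ s ∈ tb, δ ≤ |t - s|})

/-- `h` is piecewise Lipschitz continuous in a neighbourhood of `z(·)` on `[0, T]`, with exceptional
times `tb` and radii `a`. The function `h` matters on `Z` only; `r_δ` is considered for small
`δ > 0` (for large `δ` the infimum is over the empty set). -/
structure IsPiecewiseLipschitzNear {F : Type*} [PseudoMetricSpace F] (Z : Set (E n))
    (z : ℝ → E n) (h : E n → F) (T : ℝ) (tb : Finset ℝ) (a : ℝ → ℝ) : Prop where
  times_mem : ∀ s ∈ tb, s ∈ Icc 0 T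
  radius_pos : ∀ t ∈ Icc 0 T, t ∉ tb → 0 < a t
  lipschitz : ∃ L : ℝ≥0, ∀ t ∈ Icc 0 T, t ∉ tb →
    LipschitzOnWith L h (Metric.ball (z t) (a t) ∩ Z)
  tube : ∃ δ₀ : ℝ, 0 < δ₀ ∧ ∀ δ ∈ Ioo 0 δ₀, 0 < tubeRadius T tb a δ ∧
    ContinuousWithinAt (tubeRadius T tb a) (Ici δ) δ

/-- The ACG family generating `μ` is weakly piecewise Lipschitz continuous in a neighbourhood of
`z(·)`: `g̃_μ` is so, with exceptional times `tb T` and radii `a T` on `[0, T]`, and `q̃_μ` is so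
(with exceptional times and radii of its own) for every Lipschitz continuous `q` on `U × Y × Z`. -/
structure IsWeaklyPiecewiseLipschitz (g : U → E m → E n → E n) (Y : Set (E m)) (Z : Set (E n))
    (μ : E n → Measure (U × E m)) (z : ℝ → E n) (tb : ℝ → Finset ℝ) (a : ℝ → ℝ → ℝ) :
    Prop where
  drift : ∀ T : ℝ, 0 < T → IsPiecewiseLipschitzNear Z z (avg μ g) T (tb T) (a T)
  observable : ∀ q : U → E m → E n → ℝ,
    (∃ L : ℝ≥0, LipschitzOnWith L (fun p : U × E m × E n => q p.1 p.2.1 p.2.2)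
      (univ ×ˢ Y ×ˢ Z)) →
    ∀ T : ℝ, 0 < T → ∃ (tb' : Finset ℝ) (a' : ℝ → ℝ),
      IsPiecewiseLipschitzNear Z z (avg μ q) T tb' a'

/-- `γ(du, dy, dz) = μ(du, dy | z) ν(dz)`. -/
def joinMeasure (μ : E n → Measure (U × E m)) (ν : Measure (E n)) : Measure (U × E m × E n) :=
  ν.bind (fun ζ => (μ ζ).map (fun p => (p.1, p.2, ζ)))

/-! ### The control of the singularly perturbed system -/

/-- `Δ(ε) = (ε / (2 L_f)) ln (1 / ε)`. -/
def stepLength (Lf ε : ℝ) : ℝ := ε / (2 * Lf) * Real.log (1 / ε)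

/-- `u` is the control built from the steering controls `us` and `(y, z)` is the corresponding
solution of the singularly perturbed system: with `t_l = l Δ(ε)`,
`u(t) = us (y(t_l)) (z(t_l)) ((t - t_l) / ε)` for `t ∈ [t_l, t_{l+1})`, `l = 0, 1, …`. -/
structure IsSteeredTrajectory (f : U → E m → E n → E m) (g : U → E m → E n → E n)
    (y₀ : E m) (z₀ : E n) (us : E m → E n → ℝ → U) (Lf ε : ℝ)
    (u : ℝ → U) (y : ℝ → E m) (z : ℝ → E n) : Prop where
  solution : IsSPSolution f g y₀ z₀ ε u y z
  feedback : ∀ l : ℕ, ∀ t ∈ Ico (l * stepLength Lf ε) ((l + 1) * stepLength Lf ε),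
    u t = us (y (l * stepLength Lf ε)) (z (l * stepLength Lf ε)) ((t - l * stepLength Lf ε) / ε)

end ACG

end SPControl

end

namespace SPControl

/-! ### Absolutely continuous curves and a Grönwall inequality -/

/-! Write Δ for `stepLength Lf ε` and M for a bound of ‖g‖ on U × Y × Z. During a step of length Δ
the slow variable moves by at most MΔ, so it is nearly frozen. In the stretched time (t - t_l)/ε the
step has length S = Δ/ε = ln(1/ε)/(2 L_f). This tends to infinity, so the occupational measure of
the steering pair approaches μ(·|z_ε(t_l)). Yet it grows slowly enough that the Grönwall factor
e^{L_f S} is only ε^{-1/2}, and y_ε stays within MΔε^{-1/2} → 0 of the steering trajectory. Hence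
the time average of a continuous Q over a step is Q̃_μ(z_ε(t_l)) + o(1), uniformly in l
(`eventually_abs_integral_step_sub_le`).

With the coordinates of g as Q, the values z_ε(t_l) form an approximate Euler scheme for the
averaged equation, which is compared with z(·) by a discrete Grönwall inequality
(`eventually_norm_slow_sub_le`). The drift g̃_μ is Lipschitz only near z(·) and away from the
exceptional times. Steps starting within a fixed distance d of such a time are given the trivial
error 2MΔ; there are about 2d/Δ of them per exceptional time, so they cost O(d), and d is free. On
all other steps the tube condition applies once δ̄(ε) < d.

For the discounted measures it suffices to test bounded Lipschitz Q. The weight e^{-Ct} is nearly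
constant on a step, so the step estimate replaces Q along the trajectory by Q̃_μ(z_ε(t_l))
(`tendsto_discount_integral_sub`). Then Q̃_μ(z_ε(t_l)) → Q̃_μ(z(t)) for all t > 0 outside a
countable set, and dominated convergence concludes (`tendsto_discount_integral_avg`). -/

lemma _root_.AbsolutelyContinuousOnInterval.lipschitzWith_comp {F G : Type*}
    [PseudoMetricSpace F] [PseudoMetricSpace G] {x : ℝ → F} {h : F → G} {a b : ℝ}
    (hx : AbsolutelyContinuousOnInterval x a b) (hh : LipschitzWith 1 h) :
    AbsolutelyContinuousOnInterval (fun t => h (x t)) a b := by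
  rw [absolutelyContinuousOnInterval_iff] at hx ⊢
  intro ε hε
  obtain ⟨δ, hδ, H⟩ := hx ε hε
  refine ⟨δ, hδ, fun I hI hlen => lt_of_le_of_lt (Finset.sum_le_sum fun i _ => ?_) (H I hI hlen)⟩
  simpa using hh.dist_le_mul (x (I.2 i).1) (x (I.2 i).2)

lemma LocallyAC.continuousOn_Ici {F : Type*} [SeminormedAddCommGroup F] {x : ℝ → F}
    (hx : LocallyAC x) : ContinuousOn x (Ici 0) := by
  intro t ht
  have ht0 : (0 : ℝ) ≤ t := ht
  have ht1 : (0 : ℝ) ≤ t + 1 := by linarith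
  have h0 : AbsolutelyContinuousOnInterval x 0 (t + 1) := hx (t + 1) ht1
  have h := h0.continuousOn
  rw [uIcc_of_le ht1] at h
  have h2 : ContinuousWithinAt x (Icc 0 (t + 1)) t := h t ⟨ht0, by linarith⟩
  have h3 : Icc 0 (t + 1) ∈ 𝓝[Ici 0] t := by
    filter_upwards [self_mem_nhdsWithin,
      mem_nhdsWithin_of_mem_nhds (Iio_mem_nhds (lt_add_one t))] with s hs hs'
    exact ⟨hs, le_of_lt hs'⟩
  exact h2.mono_of_mem_nhdsWithin h3

lemma intervalIntegrable_euclidean {k : ℕ} {v : ℝ → E k} {a b : ℝ}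
    (h : ∀ i, IntervalIntegrable (fun t => v t i) volume a b) :
    IntervalIntegrable v volume a b := by
  have key : ∀ s : Set ℝ, (∀ i, IntegrableOn (fun t => v t i) s volume) →
      IntegrableOn v s volume := by
    intro s hs
    have h1 : Integrable (fun t => WithLp.ofLp (v t)) (volume.restrict s) :=
      Integrable.of_eval hs
    exact (PiLp.continuousLinearEquiv 2 ℝ
      (fun _ : Fin k => ℝ)).symm.toContinuousLinearMap.integrable_comp h1
  exact ⟨key _ fun i => (h i).1, key _ fun i => (h i).2⟩

lemma intervalIntegral_euclidean_apply {k : ℕ} {v : ℝ → E k} {a b : ℝ}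
    (h : IntervalIntegrable v volume a b) (i : Fin k) :
    (∫ t in a..b, v t) i = ∫ t in a..b, v t i := by
  have := (EuclideanSpace.proj i : E k →L[ℝ] ℝ).intervalIntegral_comp_comm h
  simpa using this.symm

lemma ae_uIoc_of_ae_Ici {p : ℝ → Prop} (h : ∀ᵐ t ∂(volume.restrict (Ici (0 : ℝ))), p t)
    {a b : ℝ} (ha : 0 ≤ a) (hb : 0 ≤ b) : ∀ᵐ t, t ∈ uIoc a b → p t := by
  rw [ae_restrict_iff' measurableSet_Ici] at h
  filter_upwards [h] with t ht hab
  exact ht (le_trans (le_min ha hb) hab.1.le)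

/-- The fundamental theorem of calculus for locally absolutely continuous curves in `ℝᵏ`. -/
lemma LocallyAC.integral_eq_sub {k : ℕ} {x v : ℝ → E k} (hx : LocallyAC x)
    (hv : ∀ᵐ t ∂(volume.restrict (Ici (0 : ℝ))), HasDerivAt x (v t) t) {a b : ℝ}
    (ha : 0 ≤ a) (hb : 0 ≤ b) :
    IntervalIntegrable v volume a b ∧ ∫ t in a..b, v t = x b - x a := by
  have hae := ae_uIoc_of_ae_Ici hv ha hb
  -- The scalar theorem is applied to each coordinate, coordinates being 1-Lipschitz.
  have hac : ∀ i, AbsolutelyContinuousOnInterval (fun t => x t i) a b := by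
    intro i
    have hlip : LipschitzWith 1 (fun p : E k => p i) := by
      refine LipschitzWith.of_dist_le_mul fun p r => ?_
      rw [NNReal.coe_one, one_mul, dist_eq_norm, dist_eq_norm]
      exact PiLp.norm_apply_le (p - r) i
    refine ((hx (max a b) (by positivity)).lipschitzWith_comp hlip).mono ?_
    rw [uIcc_of_le (b := max a b) (by positivity)]
    exact fun t ht => ⟨le_trans (le_min ha hb) ht.1, ht.2⟩
  have hder : ∀ i, ∀ᵐ t, t ∈ uIoc a b → deriv (fun t => x t i) t = v t i := by
    intro i
    filter_upwards [hae] with t ht hab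
    have h1 := (EuclideanSpace.proj i : E k →L[ℝ] ℝ).hasFDerivAt.comp_hasDerivAt
      t (ht hab)
    exact h1.deriv
  have hint : ∀ i, IntervalIntegrable (fun t => v t i) volume a b := fun i =>
    (hac i).intervalIntegrable_deriv.congr_ae
      ((ae_restrict_iff' measurableSet_uIoc).2 (hder i))
  have hI := intervalIntegrable_euclidean hint
  refine ⟨hI, ?_⟩
  ext i
  rw [intervalIntegral_euclidean_apply hI, ← intervalIntegral.integral_congr_ae (hder i),
    (hac i).integral_deriv_eq_sub]
  rfl

/-- Compares a curve with one Euler step of constant velocity `c`. -/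
lemma LocallyAC.norm_sub_sub_smul_le {k : ℕ} {x v : ℝ → E k} (hx : LocallyAC x)
    (hv : ∀ᵐ t ∂(volume.restrict (Ici (0 : ℝ))), HasDerivAt x (v t) t) {a b D : ℝ} (c : E k)
    (ha : 0 ≤ a) (hab : a ≤ b) (hD : ∀ t ∈ Icc a b, ‖v t - c‖ ≤ D) :
    ‖x b - x a - (b - a) • c‖ ≤ D * (b - a) := by
  obtain ⟨hi, he⟩ := hx.integral_eq_sub hv ha (ha.trans hab)
  have h1 : x b - x a - (b - a) • c = ∫ t in a..b, (v t - c) := by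
    rw [intervalIntegral.integral_sub hi intervalIntegrable_const, he,
      intervalIntegral.integral_const]
  rw [h1, ← abs_of_nonneg (sub_nonneg.2 hab)]
  refine intervalIntegral.norm_integral_le_of_norm_le_const fun t ht => hD t ?_
  rw [uIoc_of_le hab] at ht
  exact ⟨ht.1.le, ht.2⟩

lemma LocallyAC.norm_sub_le {k : ℕ} {x v : ℝ → E k} (hx : LocallyAC x)
    (hv : ∀ᵐ t ∂(volume.restrict (Ici (0 : ℝ))), HasDerivAt x (v t) t) {a b D : ℝ}
    (ha : 0 ≤ a) (hab : a ≤ b) (hD : ∀ t ∈ Icc a b, ‖v t‖ ≤ D) :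
    ‖x b - x a‖ ≤ D * (b - a) := by
  simpa using hx.norm_sub_sub_smul_le hv (D := D) 0 ha hab
    fun t ht => by simpa using hD t ht

/-- Grönwall's inequality in integral form. -/
lemma le_mul_exp_of_le_integral {w : ℝ → ℝ} {L c S : ℝ} (hL : 0 < L) (hc : 0 ≤ c)
    (hS : 0 ≤ S) (hw : ContinuousOn w (Icc 0 S)) (hw0 : ∀ s ∈ Icc 0 S, 0 ≤ w s)
    (h : ∀ τ ∈ Icc 0 S, w τ ≤ ∫ s in (0 : ℝ)..τ, L * (w s + c)) :
    ∀ τ ∈ Icc 0 S, w τ ≤ c * Real.exp (L * τ) := by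
  -- Continuous extension of `w` to the line, so that the primitive `W` is differentiable
  -- everywhere.
  set w' : ℝ → ℝ := IccExtend hS ((Icc 0 S).domRestrict w) with hw'
  have hcont : Continuous w' := (continuousOn_iff_continuous_domRestrict.1 hw).Icc_extend'
  have heq : ∀ s ∈ Icc 0 S, w' s = w s := fun s hs => by
    rw [hw', IccExtend_of_mem hS _ hs]; rfl
  have hnn : ∀ s, 0 ≤ w' s := fun s => hw0 _ (projIcc 0 S hS s).2
  set W : ℝ → ℝ := fun τ => ∫ s in (0 : ℝ)..τ, L * (w' s + c) with hW
  have hWc : Continuous fun s => L * (w' s + c) := by fun_prop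
  have hWd : ∀ τ, HasDerivAt W (L * (w' τ + c)) τ := fun τ =>
    intervalIntegral.integral_hasDerivAt_right (hWc.intervalIntegrable _ _)
      hWc.stronglyMeasurable.stronglyMeasurableAtFilter hWc.continuousAt
  have hle : ∀ τ ∈ Icc 0 S, w' τ ≤ W τ := by
    intro τ hτ
    rw [heq τ hτ]
    refine (h τ hτ).trans_eq (intervalIntegral.integral_congr fun s hs => ?_)
    rw [uIcc_of_le hτ.1] at hs
    simp only [heq s ⟨hs.1, hs.2.trans hτ.2⟩]
  intro τ hτ
  -- Since w' ≤ W, the primitive satisfies W' ≤ L W + L c with W(0) = 0, hence W ≤ c (e^{Lτ} - 1).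
  have hg := norm_le_gronwallBound_of_norm_deriv_right_le (f := W)
    (f' := fun τ => L * (w' τ + c)) (δ := 0) (K := L) (ε := L * c) (a := 0) (b := S)
    (fun s _ => (hWd s).continuousAt.continuousWithinAt) (fun s _ => (hWd s).hasDerivWithinAt)
    (by simp [hW]) (fun s hs => by
      have h1 := hle s ⟨hs.1, hs.2.le⟩
      have h2 := hnn s
      rw [Real.norm_of_nonneg (by positivity), Real.norm_of_nonneg (h2.trans h1)]
      nlinarith) τ hτ
  rw [gronwallBound_of_K_ne_0 hL.ne'] at hg
  have h1 := (heq τ hτ).symm.le.trans (hle τ hτ)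
  have h2 := (le_abs_self _).trans hg
  have h3 : L * c / L = c := by field_simp
  rw [h3, sub_zero] at h2
  linarith

/-! ### Tracking of the associated system -/

lemma _root_.IntervalIntegrable.comp_add_mul {F : Type*} [NormedAddCommGroup F] {h : ℝ → F}
    {t₀ ε τ : ℝ} (hε : 0 < ε) (hh : IntervalIntegrable h volume t₀ (t₀ + ε * τ)) :
    IntervalIntegrable (fun s => h (t₀ + ε * s)) volume 0 τ := by
  have h1 := hh.comp_add_left t₀
  have h2 := h1.comp_mul_left (c := ε)
  have e : ε * τ / ε = τ := by field_simp
  simpa [e] using h2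

/-- In the stretched time σ, y(t₀ + εσ) obeys the associated equation except that z is not frozen at
z(t₀). That defect is at most MεS, and Grönwall's inequality multiplies it by e^{L_f S}. -/
lemma IsSPSolution.dist_associated_le {U : Type*} [MeasurableSpace U] {m n : ℕ}
    {f : U → E m → E n → E m} {g : U → E m → E n → E n} {Y : Set (E m)} {Z : Set (E n)}
    {y₀ : E m} {z₀ : E n} {Lf M ε : ℝ} {u : ℝ → U} {y : ℝ → E m} {z : ℝ → E n}
    (hε : 0 < ε) (sol : IsSPSolution f g y₀ z₀ ε u y z)
    (hyz : ∀ t, 0 ≤ t → y t ∈ Y ∧ z t ∈ Z) (hLf : 0 < Lf) (hfLip : LipschitzInState Y Z f Lf)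
    (hM0 : 0 ≤ M) (hM : ∀ u, ∀ y ∈ Y, ∀ z ∈ Z, ‖g u y z‖ ≤ M) {t₀ S : ℝ} (ht₀ : 0 ≤ t₀)
    (hS : 0 ≤ S) {v : ℝ → U} {x : ℝ → E m} (hvx : IsAdmissiblePair f Y (z t₀) v x)
    (hx0 : x 0 = y t₀) (huv : ∀ σ ∈ Ico 0 S, u (t₀ + ε * σ) = v σ) :
    ∀ σ ∈ Icc 0 S, ‖z (t₀ + ε * σ) - z t₀‖ ≤ M * (ε * S) ∧
      ‖y (t₀ + ε * σ) - x σ‖ ≤ M * (ε * S) * Real.exp (Lf * S) := by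
  have hpos : ∀ σ, 0 ≤ σ → 0 ≤ t₀ + ε * σ := fun σ hσ => by positivity
  have hz : ∀ σ ∈ Icc 0 S, ‖z (t₀ + ε * σ) - z t₀‖ ≤ M * (ε * S) := by
    intro σ hσ
    have h1 : t₀ ≤ t₀ + ε * σ := le_add_of_nonneg_right (mul_nonneg hε.le hσ.1)
    have h2 := sol.ac_slow.norm_sub_le (D := M) sol.slow ht₀ h1 fun t ht =>
      hM _ _ (hyz t (ht₀.trans ht.1)).1 _ (hyz t (ht₀.trans ht.1)).2
    refine h2.trans ?_
    rw [add_sub_cancel_left]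
    exact mul_le_mul_of_nonneg_left (mul_le_mul_of_nonneg_left hσ.2 hε.le) hM0
  have hycont : ContinuousOn (fun σ => y (t₀ + ε * σ)) (Icc 0 S) :=
    sol.ac_fast.continuousOn_Ici.comp (by fun_prop) fun σ hσ => hpos σ hσ.1
  have hwcont : ContinuousOn (fun σ => ‖y (t₀ + ε * σ) - x σ‖) (Icc 0 S) :=
    (hycont.sub (hvx.ac.continuousOn_Ici.mono fun σ hσ => hσ.1)).norm
  have hG := le_mul_exp_of_le_integral (w := fun σ => ‖y (t₀ + ε * σ) - x σ‖) (L := Lf)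
    (c := M * (ε * S)) hLf (by positivity) hS hwcont (fun _ _ => norm_nonneg _) ?_
  · refine fun σ hσ => ⟨hz σ hσ, (hG σ hσ).trans ?_⟩
    gcongr
    exact hσ.2
  intro τ hτ
  obtain ⟨i1, e1⟩ := sol.ac_fast.integral_eq_sub sol.fast ht₀ (hpos τ hτ.1)
  obtain ⟨i2, e2⟩ := hvx.ac.integral_eq_sub hvx.ode le_rfl hτ.1
  -- The factor ε comes from the change of variables t = t₀ + εs, the factor ε⁻¹ from the fast
  -- equation.
  have i3 : IntervalIntegrable
      (fun s => ε • ε⁻¹ • f (u (t₀ + ε * s)) (y (t₀ + ε * s)) (z (t₀ + ε * s))) volume 0 τ :=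
    IntervalIntegrable.smul (i1.comp_add_mul hε) ε
  have e3 : ∫ s in (0 : ℝ)..τ, ε • ε⁻¹ • f (u (t₀ + ε * s)) (y (t₀ + ε * s)) (z (t₀ + ε * s))
      = y (t₀ + ε * τ) - y t₀ := by
    rw [intervalIntegral.integral_smul, intervalIntegral.smul_integral_comp_add_mul
      (fun s => ε⁻¹ • f (u s) (y s) (z s)), mul_zero, add_zero, e1]
  have e4 : y (t₀ + ε * τ) - x τ = ∫ s in (0 : ℝ)..τ,
      (ε • ε⁻¹ • f (u (t₀ + ε * s)) (y (t₀ + ε * s)) (z (t₀ + ε * s))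
        - f (v s) (x s) (z t₀)) := by
    rw [intervalIntegral.integral_sub i3 i2, e3, e2, hx0]
    abel
  rw [e4]
  refine intervalIntegral.norm_integral_le_of_norm_le hτ.1 ?_ ?_
  -- The controls agree on the half-open interval only; the endpoint is a null set.
  · filter_upwards [Measure.ae_ne volume S] with s hs hsτ
    have hsS : s ∈ Ico 0 S := ⟨hsτ.1.le, lt_of_le_of_ne (hsτ.2.trans hτ.2) hs⟩
    rw [smul_smul, mul_inv_cancel₀ hε.ne', one_smul, huv s hsS]
    have h1 := hyz _ (hpos s hsS.1)
    refine (hfLip (v s) _ h1.1 _ (hvx.mem s hsS.1) _ h1.2 _ (hyz t₀ ht₀).2).trans ?_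
    have := hz s ⟨hsS.1, hsS.2.le⟩
    gcongr
  · refine ContinuousOn.intervalIntegrable ?_
    rw [uIcc_of_le hτ.1]
    exact ((hwcont.mono (Icc_subset_Icc_right hτ.2)).add continuousOn_const).const_smul Lf

/-! ### The step length -/

lemma stepLength_pos {Lf ε : ℝ} (hLf : 0 < Lf) (hε : ε ∈ Ioo (0 : ℝ) 1) :
    0 < stepLength Lf ε := by
  have h1 := hε.1
  have : 0 < Real.log (1 / ε) := Real.log_pos (by rw [lt_div_iff₀ h1]; linarith [hε.2])
  unfold stepLength
  positivity

lemma tendsto_stepLength_div {Lf : ℝ} (hLf : 0 < Lf) :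
    Tendsto (fun ε => stepLength Lf ε / ε) (𝓝[>] 0) atTop := by
  have h1 : Tendsto (fun ε : ℝ => Real.log (1 / ε) / (2 * Lf)) (𝓝[>] 0) atTop := by
    refine Tendsto.atTop_div_const (by positivity) (Real.tendsto_log_atTop.comp ?_)
    exact tendsto_inv_nhdsGT_zero.congr fun ε => (one_div ε).symm
  refine h1.congr' ?_
  filter_upwards [self_mem_nhdsWithin] with ε hε
  have : ε ≠ 0 := ne_of_gt hε
  unfold stepLength
  field_simp

/-- The factor 2 L_f in Δ(ε) is chosen for this: e^{L_f Δ/ε} = ε^{-1/2}, while Δ is of order ε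
ln(1/ε), so the tracking error is of order √ε ln(1/ε). -/
lemma stepLength_mul_exp {Lf ε : ℝ} (hLf : 0 < Lf) (hε : 0 < ε) :
    stepLength Lf ε * Real.exp (Lf * (stepLength Lf ε / ε))
      = (2 * Lf)⁻¹ * -(Real.log ε * ε ^ (1 / 2 : ℝ)) := by
  have h1 : Lf * (stepLength Lf ε / ε) = - (Real.log ε * (1 / 2)) := by
    unfold stepLength
    rw [one_div, Real.log_inv]
    field_simp
  rw [h1, Real.exp_neg, ← Real.rpow_def_of_pos hε]
  have h2 : ε ^ (1 / 2 : ℝ) * ε ^ (1 / 2 : ℝ) = ε := by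
    rw [← Real.rpow_add hε]; norm_num
  have h3 : 0 < ε ^ (1 / 2 : ℝ) := by positivity
  unfold stepLength
  rw [one_div ε, Real.log_inv]
  generalize ε ^ (1 / 2 : ℝ) = r at h2 h3 ⊢
  rw [← h2]
  field_simp

lemma tendsto_stepLength_mul_exp {Lf : ℝ} (hLf : 0 < Lf) :
    Tendsto (fun ε => stepLength Lf ε * Real.exp (Lf * (stepLength Lf ε / ε)))
      (𝓝[>] 0) (𝓝 0) := by
  have h := (tendsto_log_mul_rpow_nhdsGT_zero (r := 1 / 2) (by norm_num)).neg.const_mul (2 * Lf)⁻¹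
  rw [neg_zero, mul_zero] at h
  refine h.congr' ?_
  filter_upwards [self_mem_nhdsWithin] with ε hε
  exact (stepLength_mul_exp hLf hε).symm

lemma tendsto_stepLength {Lf : ℝ} (hLf : 0 < Lf) :
    Tendsto (stepLength Lf) (𝓝[>] 0) (𝓝 0) := by
  -- The exponential factor is at least 1, so the stronger limit dominates.
  refine squeeze_zero' ?_ ?_ (tendsto_stepLength_mul_exp hLf)
  all_goals
    filter_upwards [Ioo_mem_nhdsGT (zero_lt_one' ℝ)] with ε hε
    have h := stepLength_pos hLf hε
    have h0 := hε.1
  · exact h.le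
  · exact le_mul_of_one_le_right h.le (Real.one_le_exp (by positivity))

/-! ### Probability measures on a compact set and the metric `ρ` -/

lemma IsProbOn.norm_integral_le {W : Type*} [MeasurableSpace W] {K : Set W}
    {G : Type*} [NormedAddCommGroup G] [NormedSpace ℝ G]
    {ν : Measure W} (hν : IsProbOn K ν) {φ : W → G} {B : ℝ}
    (hB : ∀ w ∈ K, ‖φ w‖ ≤ B) : ‖∫ w, φ w ∂ν‖ ≤ B := by
  have := hν.1
  have hmem : ∀ᵐ w ∂ν, w ∈ K := hν.2
  simpa using norm_integral_le_of_norm_le_const (hmem.mono hB)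

lemma IsTestSequence.continuousOn {W : Type*} [MetricSpace W] {K : Set W}
    {q : ℕ → W → ℝ} (hq : IsTestSequence K q) (l : ℕ) :
    ContinuousOn (q l) K := by
  obtain ⟨L, hL⟩ := hq.lipschitz l
  exact hL.continuousOn

lemma occMeasure_isProbOn {W : Type*} [MeasurableSpace W] {K : Set W} (hK : MeasurableSet K) {w : ℝ → W}
    (hw : AEMeasurable w (volume.restrict (Ici 0))) (hmem : ∀ t, 0 ≤ t → w t ∈ K) {S : ℝ}
    (hS : 0 < S) : IsProbOn K (occMeasure w S) := by
  have hw' : AEMeasurable w (volume.restrict (Icc 0 S)) :=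
    hw.mono_measure (Measure.restrict_mono Icc_subset_Ici_self le_rfl)
  refine ⟨⟨?_⟩, ?_⟩
  · rw [occMeasure, Measure.smul_apply, Measure.map_apply_of_aemeasurable hw' MeasurableSet.univ]
    simp only [preimage_univ, Measure.restrict_apply MeasurableSet.univ, univ_inter,
      Real.volume_Icc, sub_zero, smul_eq_mul]
    exact ENNReal.inv_mul_cancel (by simpa using hS) ENNReal.ofReal_ne_top
  · rw [occMeasure, Measure.smul_apply, Measure.map_apply_of_aemeasurable hw' hK.compl]
    have : (volume.restrict (Icc 0 S)) (w ⁻¹' Kᶜ) = 0 := by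
      change ∀ᵐ t ∂(volume.restrict (Icc 0 S)), w t ∈ K
      filter_upwards [ae_restrict_mem measurableSet_Icc] with t ht using hmem t ht.1
    rw [this, smul_zero]

/-- Two integrals of a function bounded by 1 differ by at most 2. This gives a summable majorant
independent of the measures. -/
lemma IsTestSequence.abs_term_le {W : Type*} [MetricSpace W] [MeasurableSpace W]
    {K : Set W} {q : ℕ → W → ℝ} (hq : IsTestSequence K q)
    {ν₁ ν₂ : Measure W} (h₁ : IsProbOn K ν₁) (h₂ : IsProbOn K ν₂) (l : ℕ) :
    ‖(1 / 2 : ℝ) ^ (l + 1) * |(∫ w, q l w ∂ν₁) - ∫ w, q l w ∂ν₂|‖ ≤ (1 / 2 : ℝ) ^ l := by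
  have a1 : |∫ w, q l w ∂ν₁| ≤ 1 := by
    rw [← Real.norm_eq_abs]; exact h₁.norm_integral_le (hq.unit_ball l)
  have a2 : |∫ w, q l w ∂ν₂| ≤ 1 := by
    rw [← Real.norm_eq_abs]; exact h₂.norm_integral_le (hq.unit_ball l)
  have a3 := abs_sub (∫ w, q l w ∂ν₁) (∫ w, q l w ∂ν₂)
  rw [Real.norm_of_nonneg (by positivity), pow_succ, mul_assoc]
  exact mul_le_of_le_one_right (by positivity) (by linarith)

lemma IsTestSequence.summable {W : Type*} [MetricSpace W] [MeasurableSpace W]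
    {K : Set W} {q : ℕ → W → ℝ} (hq : IsTestSequence K q)
    {ν₁ ν₂ : Measure W} (h₁ : IsProbOn K ν₁) (h₂ : IsProbOn K ν₂) :
    Summable fun l => (1 / 2 : ℝ) ^ (l + 1) * |(∫ w, q l w ∂ν₁) - ∫ w, q l w ∂ν₂| :=
  Summable.of_norm_bounded summable_geometric_two (hq.abs_term_le h₁ h₂)

/-- On compact sets weak* convergence entails convergence in the metric `ρ`. -/
lemma WeakStarTendsto.tendsto_rho {W : Type*} [MetricSpace W] [MeasurableSpace W]
    {K : Set W} {ν : ℝ → Measure W} {ν₀ : Measure W}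
    (h : WeakStarTendsto K ν ν₀) (hν : ∀ᶠ ε in 𝓝[>] 0, IsProbOn K (ν ε)) (hν₀ : IsProbOn K ν₀)
    {q : ℕ → W → ℝ} (hq : IsTestSequence K q) :
    Tendsto (fun ε => rho q (ν ε) ν₀) (𝓝[>] 0) (𝓝 0) := by
  have := tendsto_tsum_of_dominated_convergence (𝓕 := 𝓝[>] (0 : ℝ))
    (f := fun ε l => (1 / 2 : ℝ) ^ (l + 1) * |(∫ w, q l w ∂(ν ε)) - ∫ w, q l w ∂ν₀|)
    (g := fun _ => 0) (bound := fun l => (1 / 2 : ℝ) ^ l) summable_geometric_two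
    (fun l => by
      have h1 := h (q l) (hq.continuousOn l)
      have h2 := ((h1.sub_const (∫ w, q l w ∂ν₀)).abs).const_mul ((1 / 2 : ℝ) ^ (l + 1))
      simpa using h2)
    (hν.mono fun ε hε l => hq.abs_term_le hε hν₀ l)
  simpa [rho] using this

section Measures

variable {W : Type*} [MetricSpace W] [MeasurableSpace W] [OpensMeasurableSpace W] {K : Set W}

lemma IsProbOn.integrable {G : Type*} [NormedAddCommGroup G] {ν : Measure W} (hν : IsProbOn K ν)
    (hK : IsCompact K) {φ : W → G} (hφ : ContinuousOn φ K) : Integrable φ ν := by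
  have := hν.1
  have hmem : ∀ᵐ w ∂ν, w ∈ K := hν.2
  obtain ⟨B, hB⟩ := hK.exists_bound_of_continuousOn hφ
  have hm := hφ.aestronglyMeasurable_of_isCompact (μ := ν) hK hK.measurableSet
  rw [Measure.restrict_eq_self_of_ae_mem hmem] at hm
  exact Integrable.of_bound hm B (hmem.mono hB)

lemma IsProbOn.abs_integral_sub_le {ν : Measure W} (hν : IsProbOn K ν)
    (hK : IsCompact K) {φ ψ : W → ℝ} {B : ℝ} (hφ : ContinuousOn φ K) (hψ : ContinuousOn ψ K)
    (hB : ∀ w ∈ K, |φ w - ψ w| ≤ B) : |(∫ w, φ w ∂ν) - ∫ w, ψ w ∂ν| ≤ B := by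
  rw [← integral_sub (hν.integrable hK hφ) (hν.integrable hK hψ), ← Real.norm_eq_abs]
  exact hν.norm_integral_le hB

/-- Integrals of a continuous function are controlled by the metric `ρ`, up to a small error. -/
lemma IsTestSequence.exists_abs_integral_sub_le {q : ℕ → W → ℝ} (hq : IsTestSequence K q)
    (hK : IsCompact K) {φ : W → ℝ} (hφ : ContinuousOn φ K) {η : ℝ} (hη : 0 < η) :
    ∃ c : ℝ, 0 ≤ c ∧ ∀ ν₁ ν₂ : Measure W, IsProbOn K ν₁ → IsProbOn K ν₂ →
      |(∫ w, φ w ∂ν₁) - ∫ w, φ w ∂ν₂| ≤ η + c * rho q ν₁ ν₂ := by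
  obtain ⟨B₀, hB₀⟩ := hK.exists_bound_of_continuousOn hφ
  -- Rescaling by a positive bound brings φ into the unit ball, where the test sequence is dense.
  set B := max B₀ 1
  have hB : 0 < B := lt_max_of_lt_right one_pos
  have hφB : ContinuousOn (fun w => B⁻¹ * φ w) K := continuousOn_const.mul hφ
  obtain ⟨l, hl⟩ := hq.dense (fun w => B⁻¹ * φ w) hφB
    (fun w hw => by
      rw [abs_mul, abs_of_pos (inv_pos.2 hB), inv_mul_le_iff₀ hB, mul_one]
      exact (hB₀ w hw).trans (le_max_left _ _)) (η / (2 * B)) (by positivity)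
  refine ⟨B * 2 ^ (l + 1), by positivity, fun ν₁ ν₂ h₁ h₂ => ?_⟩
  have happrox : ∀ ν : Measure W, IsProbOn K ν →
      |(∫ w, φ w ∂ν) - B * ∫ w, q l w ∂ν| ≤ η / 2 := by
    intro ν hν
    rw [← integral_const_mul]
    refine hν.abs_integral_sub_le hK hφ (continuousOn_const.mul (hq.continuousOn l)) fun w hw => ?_
    have h := (hl w hw).le
    have e : φ w - B * q l w = - (B * (q l w - B⁻¹ * φ w)) := by field_simp; ring
    rw [e, abs_neg, abs_mul, abs_of_pos hB]
    calc B * |q l w - B⁻¹ * φ w| ≤ B * (η / (2 * B)) := by gcongr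
      _ = η / 2 := by field_simp
  -- A single term of the series is at most ρ, which costs the factor 2^{l+1}.
  have hterm := (hq.summable h₁ h₂).le_tsum l fun j _ => by positivity
  change _ ≤ rho q ν₁ ν₂ at hterm
  have hq' : |(∫ w, q l w ∂ν₁) - ∫ w, q l w ∂ν₂| ≤ 2 ^ (l + 1) * rho q ν₁ ν₂ := by
    rw [one_div, inv_pow, inv_mul_le_iff₀ (by positivity)] at hterm
    exact hterm
  have t1 := abs_le.1 (happrox ν₁ h₁)
  have t2 := abs_le.1 (happrox ν₂ h₂)
  have t3 := abs_le.1 hq'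
  rw [abs_le]
  constructor <;> nlinarith

/-! ### Occupational measures -/

lemma integral_occMeasure {w : ℝ → W} (hw : AEMeasurable w (volume.restrict (Ici 0))) {S : ℝ}
    (hS : 0 < S) {φ : W → ℝ} (hφ : Continuous φ) :
    ∫ x, φ x ∂(occMeasure w S) = S⁻¹ * ∫ t in (0 : ℝ)..S, φ (w t) := by
  have hw' : AEMeasurable w (volume.restrict (Icc 0 S)) :=
    hw.mono_measure (Measure.restrict_mono Icc_subset_Ici_self le_rfl)
  rw [occMeasure, integral_smul_measure, integral_map hw' hφ.aestronglyMeasurable,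
    ENNReal.toReal_inv, ENNReal.toReal_ofReal hS.le, intervalIntegral.integral_of_le hS.le,
    integral_Icc_eq_integral_Ioc, smul_eq_mul]

lemma intervalIntegrable_comp_of_mem (hK : IsCompact K) {w : ℝ → W}
    (hw : AEMeasurable w (volume.restrict (Ici 0))) (hmem : ∀ t, 0 ≤ t → w t ∈ K)
    {φ : W → ℝ} (hφ : Continuous φ) {a b : ℝ} (ha : 0 ≤ a) (hb : 0 ≤ b) :
    IntervalIntegrable (fun t => φ (w t)) volume a b := by
  obtain ⟨B, hB⟩ := hK.exists_bound_of_continuousOn hφ.continuousOn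
  have hsub : uIoc a b ⊆ Ici 0 := fun t ht => (le_min ha hb).trans ht.1.le
  rw [intervalIntegrable_iff]
  refine IntegrableOn.of_bound (by simp [uIoc]) ?_ B ?_
  · exact (hφ.measurable.comp_aemeasurable
      (hw.mono_measure (Measure.restrict_mono hsub le_rfl))).aestronglyMeasurable
  · filter_upwards [ae_restrict_mem measurableSet_uIoc] with t ht using hB _ (hmem t (hsub ht))

end Measures

/-! ### Averaging on one step -/

lemma IsControl.aemeasurable_triple {U : Type*} [MeasurableSpace U] {m n : ℕ}
    {u : ℝ → U} (hu : IsControl u) {y : ℝ → E m} {z : ℝ → E n}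
    (hy : LocallyAC y) (hz : LocallyAC z) :
    AEMeasurable (fun t => (u t, y t, z t)) (volume.restrict (Ici 0)) :=
  AEMeasurable.prodMk hu ((hy.continuousOn_Ici.aemeasurable measurableSet_Ici).prodMk
    (hz.continuousOn_Ici.aemeasurable measurableSet_Ici))

section Averaging

variable {U : Type*} [MetricSpace U] [CompactSpace U] {m n : ℕ} {Y : Set (E m)} {Z : Set (E n)}

lemma isCompact_univ_prod_prod (hY : IsCompact Y) (hZ : IsCompact Z) :
    IsCompact ((univ : Set U) ×ˢ Y ×ˢ Z) :=
  isCompact_univ.prod (hY.prod hZ)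

lemma exists_norm_le {G : Type*} [NormedAddCommGroup G] (hY : IsCompact Y) (hZ : IsCompact Z)
    {h : U → E m → E n → G} (hh : Continuous fun p : U × E m × E n => h p.1 p.2.1 p.2.2) :
    ∃ B : ℝ, 0 < B ∧ ∀ u, ∀ y ∈ Y, ∀ z ∈ Z, ‖h u y z‖ ≤ B := by
  obtain ⟨B, hB⟩ := (isCompact_univ_prod_prod hY hZ).exists_bound_of_continuousOn hh.continuousOn
  exact ⟨max B 1, lt_max_of_lt_right one_pos, fun u y hy z hz =>
    (hB (u, y, z) ⟨mem_univ _, hy, hz⟩).trans (le_max_left _ _)⟩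

lemma exists_modulus (hY : IsCompact Y) (hZ : IsCompact Z)
    {h : U → E m → E n → ℝ} (hh : Continuous fun p : U × E m × E n => h p.1 p.2.1 p.2.2)
    {η : ℝ} (hη : 0 < η) :
    ∃ δ : ℝ, 0 < δ ∧ ∀ u, ∀ y ∈ Y, ∀ y' ∈ Y, ∀ z ∈ Z, ∀ z' ∈ Z, ‖y - y'‖ < δ → ‖z - z'‖ < δ →
      |h u y z - h u y' z'| < η := by
  have huc := (isCompact_univ_prod_prod (U := U) hY hZ).uniformContinuousOn_of_continuous
    hh.continuousOn
  obtain ⟨δ, hδ, H⟩ := Metric.uniformContinuousOn_iff.1 huc η hη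
  refine ⟨δ, hδ, fun u y hy y' hy' z hz z' hz' h1 h2 => ?_⟩
  refine H (u, y, z) ⟨mem_univ _, hy, hz⟩ (u, y', z') ⟨mem_univ _, hy', hz'⟩ ?_
  simp only [Prod.dist_eq, dist_self, dist_eq_norm]
  exact max_lt hδ (max_lt h1 h2)

variable [MeasurableSpace U] [BorelSpace U]

/-- Uniformly in the parameter `ζ ∈ Z`, integrals of `h(·, ·, ζ)` are controlled by `ρ`. -/
lemma exists_abs_integral_sub_le_uniform (hY : IsCompact Y) (hZ : IsCompact Z)
    {q : ℕ → U × E m → ℝ} (hq : IsTestSequence (univ ×ˢ Y) q)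
    {h : U → E m → E n → ℝ} (hh : Continuous fun p : U × E m × E n => h p.1 p.2.1 p.2.2)
    {η : ℝ} (hη : 0 < η) :
    ∃ c : ℝ, 0 ≤ c ∧ ∀ ζ ∈ Z, ∀ ν₁ ν₂ : Measure (U × E m), IsProbOn (univ ×ˢ Y) ν₁ →
      IsProbOn (univ ×ˢ Y) ν₂ →
      |(∫ p, h p.1 p.2 ζ ∂ν₁) - ∫ p, h p.1 p.2 ζ ∂ν₂| ≤ η + c * rho q ν₁ ν₂ := by
  have hK : IsCompact ((univ : Set U) ×ˢ Y) := isCompact_univ.prod hY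
  have hcont : ∀ ζ, Continuous fun p : U × E m => h p.1 p.2 ζ := fun ζ =>
    hh.comp (continuous_fst.prodMk (continuous_snd.prodMk continuous_const))
  obtain ⟨δ, hδ, hmod⟩ := exists_modulus (U := U) hY hZ hh (show 0 < η / 3 by positivity)
  -- A finite net of `Z`: replacing ζ by a point of the net changes each integral by at most η/3,
  -- and the sum of the constants over the net serves for all its points.
  obtain ⟨t, htZ, htf, hcov⟩ := hZ.finite_cover_balls hδ
  choose c hc0 hc using fun ζ : E n =>
    hq.exists_abs_integral_sub_le hK (hcont ζ).continuousOn (show 0 < η / 3 by positivity)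
  refine ⟨∑ ζ ∈ htf.toFinset, c ζ, Finset.sum_nonneg fun ζ _ => hc0 ζ, fun ζ hζ ν₁ ν₂ h₁ h₂ => ?_⟩
  obtain ⟨ξ, hξt, hξ⟩ := mem_iUnion₂.1 (hcov hζ)
  rw [Metric.mem_ball, dist_eq_norm] at hξ
  have hclose : ∀ ν : Measure (U × E m), IsProbOn (univ ×ˢ Y) ν →
      |(∫ p, h p.1 p.2 ζ ∂ν) - ∫ p, h p.1 p.2 ξ ∂ν| ≤ η / 3 := fun ν hν =>
    hν.abs_integral_sub_le hK (hcont ζ).continuousOn (hcont ξ).continuousOn fun p hp =>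
      (hmod p.1 p.2 hp.2 p.2 hp.2 ζ hζ ξ (htZ hξt) (by simpa using hδ) hξ).le
  have hrho : 0 ≤ rho q ν₁ ν₂ := tsum_nonneg fun l => by positivity
  have hle : c ξ * rho q ν₁ ν₂ ≤ (∑ ζ ∈ htf.toFinset, c ζ) * rho q ν₁ ν₂ :=
    mul_le_mul_of_nonneg_right
      (Finset.single_le_sum (fun ζ _ => hc0 ζ) (htf.mem_toFinset.2 hξt)) hrho
  have t1 := abs_le.1 (hclose ν₁ h₁)
  have t2 := abs_le.1 (hclose ν₂ h₂)
  have t3 := abs_le.1 (hc ξ ν₁ ν₂ h₁ h₂)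
  rw [abs_le]
  constructor <;> linarith

/-- Along a steered trajectory, the time average of `Q` over one step is close to its average
against `μ(du, dy | z(t_l))`, uniformly in `l`. -/
lemma eventually_abs_integral_step_sub_le
    {f : U → E m → E n → E m} {g : U → E m → E n → E n}
    (hg : Continuous fun p : U × E m × E n => g p.1 p.2.1 p.2.2)
    (hY : IsCompact Y) (hZ : IsCompact Z) {Lf : ℝ} (hLf : 0 < Lf)
    (hfLip : LipschitzInState Y Z f Lf) {y₀ : E m} {z₀ : E n} {μ : E n → Measure (U × E m)}
    (hμ : ∀ ζ ∈ Z, IsProbOn (univ ×ˢ Y) (μ ζ))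
    {q : ℕ → U × E m → ℝ} (hq : IsTestSequence (univ ×ˢ Y) q)
    {us : E m → E n → ℝ → U} {ys : E m → E n → ℝ → E m}
    (hatt : IsUniformlyAttainable f Y Z q μ us ys)
    {uε : ℝ → ℝ → U} {yε : ℝ → ℝ → E m} {zε : ℝ → ℝ → E n}
    (htraj : ∀ ε ∈ Ioo (0 : ℝ) 1, IsSteeredTrajectory f g y₀ z₀ us Lf ε (uε ε) (yε ε) (zε ε))
    (hmem : ∀ ε ∈ Ioo (0 : ℝ) 1, ∀ t, 0 ≤ t → yε ε t ∈ Y ∧ zε ε t ∈ Z)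
    {Q : U → E m → E n → ℝ} (hQ : Continuous fun p : U × E m × E n => Q p.1 p.2.1 p.2.2)
    {η : ℝ} (hη : 0 < η) :
    ∀ᶠ ε in 𝓝[>] 0, ∀ l : ℕ,
      |(∫ t in (l * stepLength Lf ε)..((l + 1) * stepLength Lf ε), Q (uε ε t) (yε ε t) (zε ε t))
        - stepLength Lf ε * avg μ Q (zε ε (l * stepLength Lf ε))| ≤ η * stepLength Lf ε := by
  obtain ⟨M, hM0, hM⟩ := exists_norm_le (U := U) hY hZ hg
  obtain ⟨δ, hδ, hmod⟩ := exists_modulus (U := U) hY hZ hQ (show 0 < η / 3 by positivity)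
  obtain ⟨c, hc0, hc⟩ := exists_abs_integral_sub_le_uniform hY hZ hq hQ
    (show 0 < η / 3 by positivity)
  obtain ⟨φ, hφ, hatt'⟩ := hatt.uniform
  -- The three errors, each allowed η/3 per unit of time in total with the density error: `e1` and
  -- `e2` keep the slow drift and the tracking error below the modulus δ, and `e3` bounds the error
  -- in ρ.
  have e1 : ∀ᶠ ε in 𝓝[>] 0, M * stepLength Lf ε < δ := by
    have := (tendsto_stepLength hLf).const_mul M
    rw [mul_zero] at this
    exact this.eventually_lt_const hδ
  have e2 : ∀ᶠ ε in 𝓝[>] 0,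
      M * (stepLength Lf ε * Real.exp (Lf * (stepLength Lf ε / ε))) < δ := by
    have := (tendsto_stepLength_mul_exp hLf).const_mul M
    rw [mul_zero] at this
    exact this.eventually_lt_const hδ
  have e3 : ∀ᶠ ε in 𝓝[>] 0, c * φ (stepLength Lf ε / ε) < η / 3 := by
    have := (hφ.comp (tendsto_stepLength_div hLf)).const_mul c
    rw [mul_zero] at this
    exact this.eventually_lt_const (by positivity)
  filter_upwards [e1, e2, e3, Ioo_mem_nhdsGT (zero_lt_one' ℝ)] with ε h1 h2 h3 hε l
  have hD := stepLength_pos hLf hε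
  have hε0 : 0 < ε := hε.1
  have tr := htraj ε hε
  have fb := tr.feedback l
  have hm := hmem ε hε
  generalize hDdef : stepLength Lf ε = D at *
  have ht₀ : 0 ≤ l * D := by positivity
  have ht₀1 : 0 ≤ (l + 1) * D := by positivity
  obtain ⟨hyl, hzl⟩ := hm _ ht₀
  have hadm := hatt.admissible _ hyl _ hzl
  have hinit := hatt.init _ hyl _ hzl
  have hrho := hatt' (D / ε) (by positivity) _ hyl _ hzl
  generalize hvdef : us (yε ε (l * D)) (zε ε (l * D)) = v at *
  generalize hxdef : ys (yε ε (l * D)) (zε ε (l * D)) = x at *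
  generalize hζdef : zε ε (l * D) = ζ at *
  have hS : 0 < D / ε := by positivity
  have hεS : ε * (D / ε) = D := by field_simp
  generalize hSdef : D / ε = S at *
  have huv : ∀ σ ∈ Ico 0 S, uε ε (l * D + ε * σ) = v σ := by
    intro σ hσ
    have hσ1 : ε * σ < D := by rw [← hεS]; exact mul_lt_mul_of_pos_left hσ.2 hε0
    rw [fb (l * D + ε * σ) ⟨by nlinarith [hσ.1], by linarith⟩, add_sub_cancel_left,
      mul_div_cancel_left₀ _ hε0.ne']
  have track := tr.solution.dist_associated_le hε0 hm hLf hfLip hM0.le hM ht₀ hS.le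
    (hζdef ▸ hadm) hinit huv
  rw [hεS, hζdef] at track
  have hw := tr.solution.control.aemeasurable_triple tr.solution.ac_fast tr.solution.ac_slow
  have i1 : IntervalIntegrable (fun t => Q (uε ε t) (yε ε t) (zε ε t)) volume (l * D)
      (l * D + ε * S) :=
    intervalIntegrable_comp_of_mem (K := univ ×ˢ Y ×ˢ Z) (isCompact_univ_prod_prod hY hZ) hw
      (fun t ht => ⟨mem_univ _, hm t ht⟩) hQ ht₀ (by positivity)
  have hQζ : Continuous fun p : U × E m => Q p.1 p.2 ζ :=
    hQ.comp (continuous_fst.prodMk (continuous_snd.prodMk continuous_const))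
  have hwx : AEMeasurable (fun t => (v t, x t)) (volume.restrict (Ici 0)) :=
    AEMeasurable.prodMk hadm.control (hadm.ac.continuousOn_Ici.aemeasurable measurableSet_Ici)
  have hKm : IsCompact ((univ : Set U) ×ˢ Y) := isCompact_univ.prod hY
  have hxm : ∀ t, 0 ≤ t → (v t, x t) ∈ (univ : Set U) ×ˢ Y := fun t ht =>
    ⟨mem_univ _, hadm.mem t ht⟩
  have i2 : IntervalIntegrable (fun t => Q (v t) (x t) ζ) volume 0 S :=
    intervalIntegrable_comp_of_mem hKm hwx hxm hQζ le_rfl hS.le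
  have s1 : ∫ t in (l * D)..((l + 1) * D), Q (uε ε t) (yε ε t) (zε ε t)
      = ε * ∫ s in (0 : ℝ)..S, Q (uε ε (l * D + ε * s)) (yε ε (l * D + ε * s))
        (zε ε (l * D + ε * s)) := by
    rw [← smul_eq_mul ε, intervalIntegral.smul_integral_comp_add_mul
      (fun t => Q (uε ε t) (yε ε t) (zε ε t)), mul_zero, add_zero, hεS]
    congr 1; ring
  have s2 : |(∫ s in (0 : ℝ)..S, Q (uε ε (l * D + ε * s)) (yε ε (l * D + ε * s))
        (zε ε (l * D + ε * s))) - ∫ s in (0 : ℝ)..S, Q (v s) (x s) ζ| ≤ η / 3 * S := by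
    rw [← intervalIntegral.integral_sub (i1.comp_add_mul hε0) i2, ← Real.norm_eq_abs]
    have := intervalIntegral.norm_integral_le_of_norm_le (μ := volume) (a := 0) (b := S)
      (f := fun s => Q (uε ε (l * D + ε * s)) (yε ε (l * D + ε * s))
        (zε ε (l * D + ε * s)) - Q (v s) (x s) ζ) (g := fun _ => η / 3) hS.le ?_
        intervalIntegrable_const
    · exact this.trans_eq (by rw [intervalIntegral.integral_const, smul_eq_mul]; ring)
    filter_upwards [Measure.ae_ne volume S] with s hs hsI
    have hsS : s ∈ Ico 0 S := ⟨hsI.1.le, lt_of_le_of_ne hsI.2 hs⟩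
    obtain ⟨b1, b2⟩ := track s ⟨hsS.1, hsS.2.le⟩
    have hp : 0 ≤ l * D + ε * s := by have := hsS.1; positivity
    rw [huv s hsS]
    refine (hmod (v s) _ (hm _ hp).1 _ (hadm.mem s hsS.1) _ (hm _ hp).2 _ hzl
      (b2.trans_lt ?_) (b1.trans_lt h1)).le
    rwa [mul_assoc]
  have s3 := integral_occMeasure hwx hS hQζ
  have hocc := occMeasure_isProbOn hKm.measurableSet hwx hxm hS
  have s4 := hc ζ hzl _ _ hocc (hμ ζ hzl)
  rw [s3] at s4
  have s5 : |S⁻¹ * (∫ t in (0 : ℝ)..S, Q (v t) (x t) ζ) - avg μ Q ζ| ≤ η / 3 + η / 3 :=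
    s4.trans (add_le_add le_rfl ((mul_le_mul_of_nonneg_left hrho hc0).trans h3.le))
  rw [s1]
  generalize (∫ s in (0 : ℝ)..S, Q (uε ε (l * D + ε * s)) (yε ε (l * D + ε * s))
        (zε ε (l * D + ε * s))) = A at *
  generalize (∫ t in (0 : ℝ)..S, Q (v t) (x t) ζ) = B at *
  -- Tracking error plus averaging error, using D = εS.
  have s6 : ε * A - D * avg μ Q ζ = ε * (A - B) + D * (S⁻¹ * B - avg μ Q ζ) := by
    rw [← hεS]; field_simp; ring
  rw [s6]
  calc |ε * (A - B) + D * (S⁻¹ * B - avg μ Q ζ)|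
      ≤ |ε * (A - B)| + |D * (S⁻¹ * B - avg μ Q ζ)| := abs_add_le _ _
    _ = ε * |A - B| + D * |S⁻¹ * B - avg μ Q ζ| := by
        rw [abs_mul, abs_mul, abs_of_pos hε0, abs_of_pos hD]
    _ ≤ ε * (η / 3 * S) + D * (η / 3 + η / 3) := by gcongr
    _ = η * D := by rw [← hεS]; ring

end Averaging

/-! ### Convergence of the slow component -/

lemma norm_le_sum_abs {k : ℕ} (v : E k) : ‖v‖ ≤ ∑ i, |v i| := by
  conv_lhs => rw [← (EuclideanSpace.basisFun (Fin k) ℝ).sum_repr v]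
  refine (norm_sum_le _ _).trans_eq (Finset.sum_congr rfl fun i _ => ?_)
  rw [norm_smul]
  simp

/-! ### Steps near exceptional times, and the discrete Grönwall inequality -/

/-- Such j are integers in an interval of length 2δ/D. -/
lemma card_filter_abs_mul_sub_lt_le {D δ s : ℝ} (hD : 0 < D) (hδ : 0 < δ) (N : ℕ) :
    (((Finset.range N).filter fun j : ℕ => |j * D - s| < δ).card : ℝ) ≤ 2 * δ / D + 1 := by
  have hsub : ((Finset.range N).filter fun j : ℕ => |j * D - s| < δ).image (Nat.cast : ℕ → ℤ) ⊆
      Finset.Icc ⌈(s - δ) / D⌉ ⌊(s + δ) / D⌋ := by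
    intro i hi
    obtain ⟨j, hj, rfl⟩ := Finset.mem_image.1 hi
    have h := abs_lt.1 (Finset.mem_filter.1 hj).2
    rw [Finset.mem_Icc, Int.ceil_le, Int.le_floor, div_le_iff₀ hD, le_div_iff₀ hD]
    push_cast
    constructor <;> linarith
  have hcard := Finset.card_le_card hsub
  rw [Finset.card_image_of_injective _ Nat.cast_injective, Int.card_Icc] at hcard
  have h1 : ((⌊(s + δ) / D⌋ + 1 - ⌈(s - δ) / D⌉).toNat : ℝ) ≤ 2 * δ / D + 1 := by
    have h2 : (((⌊(s + δ) / D⌋ + 1 - ⌈(s - δ) / D⌉).toNat : ℤ) : ℝ) ≤ 2 * δ / D + 1 := by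
      rw [Int.toNat_eq_max, Int.cast_max]
      refine max_le ?_ (by push_cast; positivity)
      push_cast
      have f1 := Int.floor_le ((s + δ) / D)
      have f2 := Int.le_ceil ((s - δ) / D)
      have f3 : (s + δ) / D - (s - δ) / D = 2 * δ / D := by ring
      linarith
    exact_mod_cast h2
  exact le_trans (by exact_mod_cast hcard) h1

/-- Union bound over the exceptional times. For d proportional to D the result is O(δ + D), whatever
the number `N` of steps. -/
lemma sum_ite_near_le {D δ d : ℝ} (hD : 0 < D) (hδ : 0 < δ) (hd : 0 ≤ d) (tb : Finset ℝ)
    (N : ℕ) [DecidablePred fun j : ℕ => ∃ s ∈ tb, |j * D - s| < δ] :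
    ∑ j ∈ Finset.range N, (if ∃ s ∈ tb, |j * D - s| < δ then d else 0)
      ≤ tb.card * (2 * δ / D + 1) * d := by
  have h1 : ∀ j : ℕ, (if ∃ s ∈ tb, |j * D - s| < δ then d else 0)
      ≤ ∑ s ∈ tb, if |j * D - s| < δ then d else 0 := by
    intro j
    split_ifs with h
    · obtain ⟨s, hs, hjs⟩ := h
      refine le_trans ?_ (Finset.single_le_sum (f := fun s => if |j * D - s| < δ then d else 0)
        (fun s _ => by positivity) hs)
      simp [hjs]
    · exact Finset.sum_nonneg fun s _ => by positivity
  refine (Finset.sum_le_sum fun j _ => h1 j).trans ?_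
  rw [Finset.sum_comm, mul_assoc, ← nsmul_eq_mul]
  refine Finset.sum_le_card_nsmul _ _ _ fun s _ => ?_
  rw [← Finset.sum_filter, Finset.sum_const, nsmul_eq_mul]
  exact mul_le_mul_of_nonneg_right (card_filter_abs_mul_sub_lt_le hD hδ N) hd

/-- A discrete Grönwall inequality. -/
lemma discrete_gronwall {e b : ℕ → ℝ} {a : ℝ} {N : ℕ} (ha : 0 ≤ a) (hb : ∀ l, 0 ≤ b l)
    (h0 : e 0 = 0) (h : ∀ l < N, e (l + 1) ≤ (1 + a) * e l + b l) :
    ∀ l ≤ N, e l ≤ (1 + a) ^ l * ∑ j ∈ Finset.range l, b j := by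
  intro l hl
  induction l with
  | zero => simp [h0]
  | succ l ih =>
    have h1 := ih (Nat.le_of_succ_le hl)
    have h2 : 1 ≤ (1 + a) ^ (l + 1) := one_le_pow₀ (by linarith)
    have h3 : b l ≤ (1 + a) ^ (l + 1) * b l := le_mul_of_one_le_left (hb l) h2
    calc e (l + 1) ≤ (1 + a) * e l + b l := h l hl
      _ ≤ (1 + a) * ((1 + a) ^ l * ∑ j ∈ Finset.range l, b j) + (1 + a) ^ (l + 1) * b l := by
        gcongr
      _ = _ := by rw [Finset.sum_range_succ]; ring

lemma one_add_pow_le_exp {a : ℝ} (ha : 0 ≤ a) (l : ℕ) : (1 + a) ^ l ≤ Real.exp (l * a) := by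
  rw [Real.exp_nat_mul]
  exact pow_le_pow_left₀ (by linarith) (by linarith [Real.add_one_le_exp a]) l

/-- Provides one radius valid at all times δ-far from the exceptional ones, so that a single
smallness condition on the step serves them all. -/
lemma IsPiecewiseLipschitzNear.tubeRadius_le {F : Type*} [PseudoMetricSpace F] {n : ℕ}
    {Z : Set (E n)} {z : ℝ → E n} {h : E n → F} {T : ℝ} {tb : Finset ℝ} {a : ℝ → ℝ}
    (hh : IsPiecewiseLipschitzNear Z z h T tb a) {δ t : ℝ} (hδ : 0 < δ) (ht : t ∈ Icc 0 T)
    (hs : ∀ s ∈ tb, δ ≤ |t - s|) : tubeRadius T tb a δ ≤ a t := by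
  refine csInf_le ⟨0, ?_⟩ ⟨t, ⟨ht, hs⟩, rfl⟩
  rintro _ ⟨r, ⟨hr, hrs⟩, rfl⟩
  refine (hh.radius_pos r hr fun hmem => ?_).le
  have := hrs r hmem
  rw [sub_self, abs_zero] at this
  linarith

/-! ### The slow motion as a perturbed Euler scheme -/

section Slow

variable {U : Type*} [MetricSpace U] [CompactSpace U] [MeasurableSpace U] [BorelSpace U]
  {m n : ℕ} {Y : Set (E m)} {Z : Set (E n)} {f : U → E m → E n → E m} {g : U → E m → E n → E n}
  {y₀ : E m} {z₀ : E n} {Lf : ℝ} {μ : E n → Measure (U × E m)} {q : ℕ → U × E m → ℝ}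
  {us : E m → E n → ℝ → U} {ys : E m → E n → ℝ → E m}
  {uε : ℝ → ℝ → U} {yε : ℝ → ℝ → E m} {zε : ℝ → ℝ → E n}

lemma avg_apply (hY : IsCompact Y) (hμ : ∀ ζ ∈ Z, IsProbOn (univ ×ˢ Y) (μ ζ))
    (hg : Continuous fun p : U × E m × E n => g p.1 p.2.1 p.2.2) {ζ : E n} (hζ : ζ ∈ Z)
    (i : Fin n) : avg μ g ζ i = avg μ (fun u y z => g u y z i) ζ := by
  have hcont : Continuous fun p : U × E m => g p.1 p.2 ζ :=
    hg.comp (continuous_fst.prodMk (continuous_snd.prodMk continuous_const))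
  have := (EuclideanSpace.proj (𝕜 := ℝ) i : E n →L[ℝ] ℝ).integral_comp_comm
    ((hμ ζ hζ).integrable (isCompact_univ.prod hY) hcont.continuousOn)
  exact this.symm

/-- The averaging estimate is used for each coordinate of `g` with tolerance η/(n+1); the n
coordinates then add up to at most η, and n + 1 also covers n = 0. -/
lemma eventually_norm_slow_step_sub_le
    (hg : Continuous fun p : U × E m × E n => g p.1 p.2.1 p.2.2)
    (hY : IsCompact Y) (hZ : IsCompact Z) (hLf : 0 < Lf) (hfLip : LipschitzInState Y Z f Lf)
    (hμ : ∀ ζ ∈ Z, IsProbOn (univ ×ˢ Y) (μ ζ)) (hq : IsTestSequence (univ ×ˢ Y) q)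
    (hatt : IsUniformlyAttainable f Y Z q μ us ys)
    (htraj : ∀ ε ∈ Ioo (0 : ℝ) 1, IsSteeredTrajectory f g y₀ z₀ us Lf ε (uε ε) (yε ε) (zε ε))
    (hmem : ∀ ε ∈ Ioo (0 : ℝ) 1, ∀ t, 0 ≤ t → yε ε t ∈ Y ∧ zε ε t ∈ Z)
    {η : ℝ} (hη : 0 < η) :
    ∀ᶠ ε in 𝓝[>] 0, ∀ l : ℕ,
      ‖zε ε ((l + 1) * stepLength Lf ε) - zε ε (l * stepLength Lf ε)
        - stepLength Lf ε • avg μ g (zε ε (l * stepLength Lf ε))‖ ≤ η * stepLength Lf ε := by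
  have hcoord : ∀ i : Fin n, Continuous fun p : U × E m × E n => g p.1 p.2.1 p.2.2 i := fun i =>
    (EuclideanSpace.proj (𝕜 := ℝ) i : E n →L[ℝ] ℝ).continuous.comp hg
  have hη' : 0 < η / (n + 1) := by positivity
  filter_upwards [eventually_all.2 fun i => eventually_abs_integral_step_sub_le hg hY hZ hLf hfLip
    hμ hq hatt htraj hmem (Q := fun u y z => g u y z i) (hcoord i) hη', Ioo_mem_nhdsGT (zero_lt_one' ℝ)] with ε h hε l
  have hD := stepLength_pos hLf hε
  have sol := (htraj ε hε).solution
  generalize stepLength Lf ε = D at *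
  have ht₀ : 0 ≤ l * D := by positivity
  have ht₁ : 0 ≤ (l + 1) * D := by positivity
  obtain ⟨hi, he⟩ := sol.ac_slow.integral_eq_sub sol.slow ht₀ ht₁
  refine (norm_le_sum_abs _).trans ?_
  have : ∀ i ∈ Finset.univ, |(zε ε ((l + 1) * D) - zε ε (l * D)
      - D • avg μ g (zε ε (l * D))) i| ≤ η / (n + 1) * D := by
    intro i _
    rw [← he, PiLp.sub_apply, PiLp.smul_apply, intervalIntegral_euclidean_apply hi,
      avg_apply hY hμ hg (hmem ε hε _ ht₀).2, smul_eq_mul]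
    exact h i l
  refine (Finset.sum_le_card_nsmul _ _ _ this).trans ?_
  rw [Finset.card_univ, Fintype.card_fin, nsmul_eq_mul, ← mul_assoc]
  gcongr
  rw [mul_div_assoc', div_le_iff₀ (by positivity)]
  nlinarith

/-- The slow components converge to the solution of the averaged equation, uniformly on
`[0, T]`. -/
lemma eventually_norm_slow_sub_le
    (hg : Continuous fun p : U × E m × E n => g p.1 p.2.1 p.2.2)
    (hY : IsCompact Y) (hZ : IsCompact Z) (hLf : 0 < Lf) (hfLip : LipschitzInState Y Z f Lf)
    (hμ : ∀ ζ ∈ Z, IsProbOn (univ ×ˢ Y) (μ ζ)) (hq : IsTestSequence (univ ×ˢ Y) q)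
    (hatt : IsUniformlyAttainable f Y Z q μ us ys)
    (htraj : ∀ ε ∈ Ioo (0 : ℝ) 1, IsSteeredTrajectory f g y₀ z₀ us Lf ε (uε ε) (yε ε) (zε ε))
    (hmem : ∀ ε ∈ Ioo (0 : ℝ) 1, ∀ t, 0 ≤ t → yε ε t ∈ Y ∧ zε ε t ∈ Z)
    {z : ℝ → E n} (hz : IsAveragedSolution g μ Z z₀ z) {T : ℝ} (hT : 0 < T)
    {tb : Finset ℝ} {a : ℝ → ℝ} (hpl : IsPiecewiseLipschitzNear Z z (avg μ g) T tb a)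
    {δ : ℝ → ℝ} (hδ : Tendsto δ (𝓝[>] 0) (𝓝 0))
    (htube : ∀ᶠ ε in 𝓝[>] (0 : ℝ), ∀ t ∈ Icc 0 T, (∀ s ∈ tb, δ ε ≤ |t - s|) →
      zε ε t ∈ Metric.ball (z t) (a t))
    {η : ℝ} (hη : 0 < η) :
    ∀ᶠ ε in 𝓝[>] 0, ∀ t ∈ Icc 0 T, ‖zε ε t - z t‖ ≤ η := by
  classical
  obtain ⟨M, hM0, hM⟩ := exists_norm_le (U := U) hY hZ hg
  obtain ⟨L, hL⟩ := hpl.lipschitz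
  obtain ⟨δ₀, hδ₀, hr⟩ := hpl.tube
  set X := Real.exp (L * T) with hX
  have hX0 : 0 < X := Real.exp_pos _
  set k : ℝ := (tb.card : ℝ) with hk
  have hk0 : 0 ≤ k := Nat.cast_nonneg _
  -- `d` does not depend on ε. It makes the cost 4Mkd of the bad steps, amplified by the Grönwall
  -- factor `X`, at most η/4.
  set d := min (δ₀ / 2) (η / (16 * M * (k + 1) * X)) with hd
  have hd0 : 0 < d := by positivity
  have hdδ : d ∈ Ioo 0 δ₀ := ⟨hd0, (min_le_left _ _).trans_lt (by linarith)⟩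
  have hdη : X * (4 * M * k * d) ≤ η / 4 := by
    have h1 : d ≤ η / (16 * M * (k + 1) * X) := min_le_right _ _
    rw [le_div_iff₀ (by positivity)] at h1
    have h2 : 0 ≤ X * (M * d) := by positivity
    nlinarith
  -- Averaging tolerance: accumulated over [0, T] and amplified by `X`, it costs at most η/4.
  set ψ := η / (4 * (T + 1) * X) with hψ
  have hψ0 : 0 < ψ := by positivity
  have hψη : X * (T * ψ) ≤ η / 4 := by
    have h1 : ψ * (4 * (T + 1) * X) = η := by rw [hψ]; field_simp
    have h2 : 0 ≤ X * ψ := by positivity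
    nlinarith
  have hgM : ∀ ζ ∈ Z, ‖avg μ g ζ‖ ≤ M := fun ζ hζ =>
    (hμ ζ hζ).norm_integral_le fun p hp => hM p.1 p.2 hp.2 ζ hζ
  have hD0 := tendsto_stepLength hLf
  -- Keeps z(·) over a whole good step inside the ball around its value at the start of the step.
  have e1 : ∀ᶠ ε in 𝓝[>] 0, M * stepLength Lf ε < tubeRadius T tb a d := by
    have := hD0.const_mul M
    rw [mul_zero] at this
    exact this.eventually_lt_const (hr d hdδ).1
  have e2 : ∀ᶠ ε in 𝓝[>] 0,
      (X * (T * (L * M) + 2 * M * k) + 2 * M) * stepLength Lf ε < η / 4 := by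
    have := hD0.const_mul (X * (T * (L * M) + 2 * M * k) + 2 * M)
    rw [mul_zero] at this
    exact this.eventually_lt_const (by positivity)
  filter_upwards [e1, e2, htube, hδ.eventually_lt_const hd0, Ioo_mem_nhdsGT (zero_lt_one' ℝ),
    eventually_norm_slow_step_sub_le hg hY hZ hLf hfLip hμ hq hatt htraj hmem hψ0]
    with ε h1 h2 h3 h4 hε hstep t ht
  have hD := stepLength_pos hLf hε
  have sol := (htraj ε hε).solution
  have hm := hmem ε hε
  generalize stepLength Lf ε = D at *
  have slow_le : ∀ r s, 0 ≤ r → r ≤ s → ‖zε ε s - zε ε r‖ ≤ M * (s - r) := fun r s hr hrs =>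
    sol.ac_slow.norm_sub_le sol.slow hr hrs fun t ht =>
      hM _ _ (hm t (hr.trans ht.1)).1 _ (hm t (hr.trans ht.1)).2
  have avg_le : ∀ r s, 0 ≤ r → r ≤ s → ‖z s - z r‖ ≤ M * (s - r) := fun r s hr hrs =>
    hz.ac.norm_sub_le hz.ode hr hrs fun t ht => hgM _ (hz.mem t (hr.trans ht.1))
  set N := ⌊t / D⌋₊ with hN
  have hND : N * D ≤ t := by
    rw [← le_div_iff₀ hD]; exact Nat.floor_le (div_nonneg ht.1 hD.le)
  have hND' : t ≤ (N + 1) * D := by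
    rw [← div_le_iff₀ hD]; exact (Nat.lt_floor_add_one _).le
  set e : ℕ → ℝ := fun l => ‖zε ε (l * D) - z (l * D)‖ with he
  -- Error committed in one step: discretization and averaging on every step, plus a trivial bound
  -- on the steps starting near an exceptional time.
  set b : ℕ → ℝ := fun l => D * (L * M * D + ψ) +
    (if ∃ s ∈ tb, |l * D - s| < d then 2 * M * D else 0) with hb
  have hrec : ∀ l < N, e (l + 1) ≤ (1 + L * D) * e l + b l := by
    intro l hl
    have ht₀ : 0 ≤ l * D := by positivity
    have hlT : l * D ≤ T := by
      refine le_trans ?_ (hND.trans ht.2)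
      have : (l : ℝ) ≤ N := by exact_mod_cast hl.le
      gcongr
    have hle : l * D ≤ (l + 1) * D := by linarith
    have hlen : (l + 1) * D - l * D = D := by ring
    simp only [he, hb, Nat.cast_add, Nat.cast_one]
    set ζ := zε ε (l * D) with hζ
    split_ifs with hbad
    -- Bad step: both curves have speed at most M, so their distance grows by at most 2MD.
    · have s1 := slow_le _ _ ht₀ hle
      have s2 := avg_le _ _ ht₀ hle
      rw [hlen] at s1 s2
      have s3 : zε ε ((l + 1) * D) - z ((l + 1) * D) = (ζ - z (l * D)) +
          (zε ε ((l + 1) * D) - ζ) - (z ((l + 1) * D) - z (l * D)) := by abel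
      have s4 : 0 ≤ L * D * ‖ζ - z (l * D)‖ := by positivity
      have s5 : 0 ≤ D * (L * M * D + ψ) := by positivity
      rw [s3]
      have := norm_sub_le ((ζ - z (l * D)) + (zε ε ((l + 1) * D) - ζ))
        (z ((l + 1) * D) - z (l * D))
      have := norm_add_le (ζ - z (l * D)) (zε ε ((l + 1) * D) - ζ)
      linarith
    · have hgood : ∀ s ∈ tb, d ≤ |l * D - s| := fun s hs =>
        not_lt.1 fun h => hbad ⟨s, hs, h⟩
      have hball := h3 (l * D) ⟨ht₀, hlT⟩ fun s hs => h4.le.trans (hgood s hs)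
      have hrad := hpl.tubeRadius_le hd0 ⟨ht₀, hlT⟩ hgood
      have hnot : (l * D) ∉ tb := fun hs => by
        have := hgood _ hs
        rw [sub_self, abs_zero] at this
        linarith
      have hlip := hL (l * D) ⟨ht₀, hlT⟩ hnot
      have s1 := hstep l
      -- Good step: z(r) and ζ both lie in the ball where g̃_μ is Lipschitz, the latter by the tube
      -- condition, so the drift along z(·) can be compared with its value at ζ.
      have s2 := hz.ac.norm_sub_sub_smul_le hz.ode (avg μ g ζ) ht₀ hle
        (D := L * (M * D + ‖ζ - z (l * D)‖)) fun r hr => by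
          have hr0 := ht₀.trans hr.1
          have hzr := avg_le _ _ ht₀ hr.1
          have hzr' : ‖z r - z (l * D)‖ ≤ M * D :=
            hzr.trans (mul_le_mul_of_nonneg_left (by linarith [hr.2]) hM0.le)
          have := hlip.dist_le_mul (z r) ⟨by
              rw [Metric.mem_ball, dist_eq_norm]; linarith, hz.mem r hr0⟩
            ζ ⟨hball, (hm _ ht₀).2⟩
          rw [dist_eq_norm, dist_eq_norm] at this
          refine this.trans (mul_le_mul_of_nonneg_left ?_ L.2)
          have h5 : z r - ζ = (z r - z (l * D)) - (ζ - z (l * D)) := by abel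
          rw [h5]
          exact (norm_sub_le _ _).trans (by linarith)
      rw [hlen] at s2
      have s3 : zε ε ((l + 1) * D) - z ((l + 1) * D) = (ζ - z (l * D)) +
          (zε ε ((l + 1) * D) - ζ - D • avg μ g ζ) -
          (z ((l + 1) * D) - z (l * D) - D • avg μ g ζ) := by abel
      rw [s3]
      have := norm_sub_le ((ζ - z (l * D)) + (zε ε ((l + 1) * D) - ζ - D • avg μ g ζ))
        (z ((l + 1) * D) - z (l * D) - D • avg μ g ζ)
      have := norm_add_le (ζ - z (l * D)) (zε ε ((l + 1) * D) - ζ - D • avg μ g ζ)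
      nlinarith
  have hgron := discrete_gronwall (e := e) (b := b) (a := L * D) (N := N) (by positivity)
    (fun l => by positivity) (by simp [he, sol.init_slow, hz.init]) hrec N le_rfl
  have hNT : N * D ≤ T := hND.trans ht.2
  have hpow : (1 + L * D) ^ N ≤ X := by
    refine (one_add_pow_le_exp (by positivity) N).trans (Real.exp_le_exp.2 ?_)
    calc N * (L * D) = L * (N * D) := by ring
      _ ≤ L * T := by gcongr
  have hsum : ∑ j ∈ Finset.range N, b j ≤
      T * (L * M * D + ψ) + k * (2 * d / D + 1) * (2 * M * D) := by
    simp only [hb]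
    rw [Finset.sum_add_distrib]
    refine add_le_add ?_ (sum_ite_near_le hD hd0 (by positivity) tb N)
    rw [Finset.sum_const, Finset.card_range, nsmul_eq_mul, ← mul_assoc]
    gcongr
  have hsum' : k * (2 * d / D + 1) * (2 * M * D) = 4 * M * k * d + 2 * M * k * D := by
    field_simp; ring
  have hbnn : 0 ≤ ∑ j ∈ Finset.range N, b j := Finset.sum_nonneg fun j _ => by positivity
  have heN : e N ≤ X * (T * (L * M * D + ψ) + (4 * M * k * d + 2 * M * k * D)) := by
    rw [← hsum']
    exact hgron.trans (mul_le_mul hpow hsum hbnn hX0.le)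
  have hN0 : 0 ≤ N * D := by positivity
  -- From the last grid point to `t` the curves separate by at most 2MD; the total error is then
  -- below 3η/4.
  have f1 := slow_le _ _ hN0 hND
  have f2 := avg_le _ _ hN0 hND
  have f3 : M * (t - N * D) ≤ M * D := mul_le_mul_of_nonneg_left (by linarith) hM0.le
  have f4 : zε ε t - z t = (zε ε (N * D) - z (N * D)) + (zε ε t - zε ε (N * D))
      - (z t - z (N * D)) := by abel
  rw [f4]
  have g1 := norm_sub_le ((zε ε (N * D) - z (N * D)) + (zε ε t - zε ε (N * D)))
    (z t - z (N * D))
  have g2 := norm_add_le (zε ε (N * D) - z (N * D)) (zε ε t - zε ε (N * D))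
  have g3 : e N = ‖zε ε (N * D) - z (N * D)‖ := rfl
  nlinarith

end Slow

/-! ### Discounted occupational measures -/

section Discounted

variable {W : Type*} [MeasurableSpace W] {C : ℝ} {w : ℝ → W}

lemma lintegral_discount (hC : 0 < C) :
    ∫⁻ t in Ici (0 : ℝ), ENNReal.ofReal (C * Real.exp (-C * t)) = 1 := by
  rw [← ProbabilityTheory.lintegral_exponentialPDF_eq_one hC,
    ← lintegral_indicator measurableSet_Ici]
  refine lintegral_congr fun t => ?_
  rw [ProbabilityTheory.exponentialPDF_eq]
  by_cases ht : 0 ≤ t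
  · rw [indicator_of_mem (mem_Ici.2 ht), if_pos ht, neg_mul]
  · rw [indicator_of_notMem (by simpa using ht), if_neg ht, ENNReal.ofReal_zero]

lemma aemeasurable_discount (hw : AEMeasurable w (volume.restrict (Ici 0))) :
    AEMeasurable w ((volume.restrict (Ici 0)).withDensity
      (fun t => ENNReal.ofReal (C * Real.exp (-C * t)))) :=
  hw.mono_ac (withDensity_absolutelyContinuous _ _)

lemma discOccMeasure_isProbOn (hC : 0 < C) {K : Set W} (hK : MeasurableSet K)
    (hw : AEMeasurable w (volume.restrict (Ici 0))) (hmem : ∀ t, 0 ≤ t → w t ∈ K) :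
    IsProbOn K (discOccMeasure C w) := by
  refine ⟨⟨?_⟩, ?_⟩
  · rw [discOccMeasure, Measure.map_apply_of_aemeasurable (aemeasurable_discount hw)
      MeasurableSet.univ, preimage_univ, withDensity_apply _ MeasurableSet.univ,
      Measure.restrict_univ, lintegral_discount hC]
  · rw [discOccMeasure, Measure.map_apply_of_aemeasurable (aemeasurable_discount hw) hK.compl]
    refine withDensity_absolutelyContinuous _ _ ?_
    change ∀ᵐ t ∂(volume.restrict (Ici 0)), w t ∈ K
    filter_upwards [ae_restrict_mem measurableSet_Ici] with t ht using hmem t ht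

lemma integral_discOccMeasure (hC : 0 < C) (hw : AEMeasurable w (volume.restrict (Ici 0)))
    {φ : W → ℝ} (hφ : AEStronglyMeasurable φ (discOccMeasure C w)) :
    ∫ x, φ x ∂(discOccMeasure C w) = ∫ t in Ioi (0 : ℝ), C * Real.exp (-C * t) * φ (w t) := by
  rw [discOccMeasure] at hφ ⊢
  rw [integral_map (aemeasurable_discount hw) hφ,
    integral_withDensity_eq_integral_toReal_smul (by fun_prop) (by simp),
    integral_Ici_eq_integral_Ioi]
  refine integral_congr_ae (Eventually.of_forall fun t => ?_)
  simp only [smul_eq_mul]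
  rw [ENNReal.toReal_ofReal (by positivity)]

end Discounted

/-! ### The limit measure -/

lemma IsProbOn.restrict_eq {W : Type*} [MeasurableSpace W] {K : Set W} {ν : Measure W}
    (hν : IsProbOn K ν) : ν.restrict K = ν := by
  have hmem : ∀ᵐ w ∂ν, w ∈ K := hν.2
  exact Measure.restrict_eq_self_of_ae_mem hmem

lemma measurable_prod_const {U : Type*} [MeasurableSpace U] {m n : ℕ} (ζ : E n) : Measurable fun p : U × E m => (p.1, p.2, ζ) := by
  fun_prop

lemma aestronglyMeasurable_avg {U : Type*} [MeasurableSpace U] {m n : ℕ} {Z : Set (E n)}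
    {μ : E n → Measure (U × E m)} {ν : Measure (E n)} (hZ : IsCompact Z)
    {Q : U → E m → E n → ℝ} (hQ : Measurable (fun ζ : Z => avg μ Q (ζ : E n)))
    (hν : IsProbOn Z ν) : AEStronglyMeasurable (avg μ Q) ν := by
  rw [← hν.restrict_eq]
  exact (aemeasurable_restrict_of_measurable_subtype hZ.measurableSet hQ).aestronglyMeasurable

section Join

variable {U : Type*} [MetricSpace U] [CompactSpace U] [MeasurableSpace U] [BorelSpace U]
  {m n : ℕ} {Y : Set (E m)} {Z : Set (E n)} {μ : E n → Measure (U × E m)} {ν : Measure (E n)}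

lemma IsProbOn.map_prod_const {ζ : E n} (hY : IsCompact Y) (hZ : IsCompact Z) (hζ : ζ ∈ Z)
    (hμ : IsProbOn (univ ×ˢ Y) (μ ζ)) :
    IsProbOn (univ ×ˢ Y ×ˢ Z) ((μ ζ).map fun p => (p.1, p.2, ζ)) := by
  have := hμ.1
  refine ⟨Measure.isProbabilityMeasure_map (measurable_prod_const ζ).aemeasurable, ?_⟩
  rw [Measure.map_apply (measurable_prod_const ζ)
    (isCompact_univ_prod_prod hY hZ).measurableSet.compl]
  refine measure_mono_null (fun p hp => ?_) hμ.2
  exact fun hpY => hp ⟨mem_univ _, hpY.2, hζ⟩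

/-- Justifies the use of `Measure.bind`. Measurability in ζ is given for integrals of continuous
functions; it passes to closed sets, whose indicators are limits of thickened indicators, and closed
sets form a generating π-system. -/
lemma aemeasurable_map_prod_const (hY : IsCompact Y) (hZ : IsCompact Z)
    (hμ : ∀ ζ ∈ Z, IsProbOn (univ ×ˢ Y) (μ ζ))
    (hmeas : ∀ q : U → E m → E n → ℝ,
      ContinuousOn (fun p : U × E m × E n => q p.1 p.2.1 p.2.2) (univ ×ˢ Y ×ˢ Z) →
      Measurable (fun ζ : Z => avg μ q (ζ : E n))) (hν : IsProbOn Z ν) :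
    AEMeasurable (fun ζ => (μ ζ).map fun p => (p.1, p.2, ζ)) ν := by
  rw [← hν.restrict_eq]
  refine aemeasurable_restrict_of_measurable_subtype hZ.measurableSet ?_
  have hprob : ∀ ζ : Z, IsProbabilityMeasure ((μ (ζ : E n)).map fun p => (p.1, p.2, (ζ : E n))) :=
    fun ζ => ((hμ ζ ζ.2).map_prod_const hY hZ ζ.2).1
  refine Measurable.measure_of_isPiSystem_of_isProbabilityMeasure
    (S := {F | IsClosed F}) ?_ isPiSystem_isClosed fun F hF => ?_
  · rw [← borel_eq_generateFrom_isClosed]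
    exact BorelSpace.measurable_eq
  have hpos : ∀ k : ℕ, (0 : ℝ) < 1 / ((k : ℝ) + 1) := fun k => by positivity
  refine measurable_of_tendsto_metrizable (f := fun (k : ℕ) (ζ : Z) =>
    ∫⁻ x, (thickenedIndicator (hpos k) F x : ℝ≥0∞)
      ∂((μ (ζ : E n)).map fun p => (p.1, p.2, (ζ : E n)))) (fun k => ?_) ?_
  · have hc : Continuous fun p : U × E m × E n => (thickenedIndicator (hpos k) F p : ℝ) :=
      NNReal.continuous_coe.comp (thickenedIndicator (hpos k) F).continuous
    have h1 := (hmeas (fun u y z => (thickenedIndicator (hpos k) F (u, y, z) : ℝ))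
      hc.continuousOn).ennreal_ofReal
    convert! h1 using 2 with ζ
    have hint := ((hμ ζ ζ.2).map_prod_const hY hZ ζ.2).integrable
      (isCompact_univ_prod_prod hY hZ) hc.continuousOn
    rw [lintegral_coe_eq_integral _ hint,
      integral_map (measurable_prod_const _).aemeasurable hc.aestronglyMeasurable]
    rfl
  · rw [tendsto_pi_nhds]
    intro ζ
    have := hprob ζ
    exact tendsto_lintegral_thickenedIndicator_of_isClosed _ hF hpos
      tendsto_one_div_add_atTop_nhds_zero_nat

lemma joinMeasure_isProbOn (hY : IsCompact Y) (hZ : IsCompact Z)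
    (hμ : ∀ ζ ∈ Z, IsProbOn (univ ×ˢ Y) (μ ζ))
    (hm : AEMeasurable (fun ζ => (μ ζ).map fun p => (p.1, p.2, ζ)) ν) (hν : IsProbOn Z ν) :
    IsProbOn (univ ×ˢ Y ×ˢ Z) (joinMeasure μ ν) := by
  have hmem : ∀ᵐ ζ ∂ν, ζ ∈ Z := hν.2
  have := hν.1
  refine ⟨⟨?_⟩, ?_⟩
  · rw [joinMeasure, Measure.bind_apply MeasurableSet.univ hm]
    have : ∀ᵐ ζ ∂ν, ((μ ζ).map fun p => (p.1, p.2, ζ)) univ = 1 := hmem.mono fun ζ hζ =>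
      ((hμ ζ hζ).map_prod_const hY hZ hζ).1.measure_univ
    rw [lintegral_congr_ae this]
    simp
  · rw [joinMeasure, Measure.bind_apply
      (isCompact_univ_prod_prod hY hZ).measurableSet.compl hm]
    have : ∀ᵐ ζ ∂ν, ((μ ζ).map fun p => (p.1, p.2, ζ)) (univ ×ˢ Y ×ˢ Z)ᶜ = 0 :=
      hmem.mono fun ζ hζ => ((hμ ζ hζ).map_prod_const hY hZ hζ).2
    rw [lintegral_congr_ae this]
    simp

lemma integral_joinMeasure_of_nonneg (hY : IsCompact Y) (hZ : IsCompact Z)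
    (hμ : ∀ ζ ∈ Z, IsProbOn (univ ×ˢ Y) (μ ζ))
    (hm : AEMeasurable (fun ζ => (μ ζ).map fun p => (p.1, p.2, ζ)) ν) (hν : IsProbOn Z ν)
    {Q : U → E m → E n → ℝ} (hQ : Continuous fun p : U × E m × E n => Q p.1 p.2.1 p.2.2)
    (hQm : Measurable (fun ζ : Z => avg μ Q (ζ : E n))) (hQ0 : ∀ u y z, 0 ≤ Q u y z) :
    ∫ p, Q p.1 p.2.1 p.2.2 ∂(joinMeasure μ ν) = ∫ ζ, avg μ Q ζ ∂ν := by
  have hmem : ∀ᵐ ζ ∂ν, ζ ∈ Z := hν.2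
  have havg0 : ∀ ζ, 0 ≤ avg μ Q ζ := fun ζ => integral_nonneg fun p => hQ0 _ _ _
  rw [integral_eq_lintegral_of_nonneg_ae (Eventually.of_forall fun p => hQ0 _ _ _)
      hQ.aestronglyMeasurable,
    integral_eq_lintegral_of_nonneg_ae (Eventually.of_forall havg0)
      (aestronglyMeasurable_avg hZ hQm hν), joinMeasure,
    Measure.lintegral_bind hm hQ.measurable.ennreal_ofReal.aemeasurable]
  congr 1
  refine lintegral_congr_ae (hmem.mono fun ζ hζ => ?_)
  have hP := (hμ ζ hζ).map_prod_const hY hZ hζ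
  simp only
  rw [← ofReal_integral_eq_lintegral_ofReal
    (hP.integrable (isCompact_univ_prod_prod hY hZ) hQ.continuousOn)
    (Eventually.of_forall fun p => hQ0 _ _ _),
    integral_map (measurable_prod_const _).aemeasurable hQ.aestronglyMeasurable]
  rfl

lemma integral_joinMeasure (hY : IsCompact Y) (hZ : IsCompact Z)
    (hμ : ∀ ζ ∈ Z, IsProbOn (univ ×ˢ Y) (μ ζ))
    (hmeas : ∀ q : U → E m → E n → ℝ,
      ContinuousOn (fun p : U × E m × E n => q p.1 p.2.1 p.2.2) (univ ×ˢ Y ×ˢ Z) →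
      Measurable (fun ζ : Z => avg μ q (ζ : E n))) (hν : IsProbOn Z ν)
    {Q : U → E m → E n → ℝ} (hQ : Continuous fun p : U × E m × E n => Q p.1 p.2.1 p.2.2)
    {B : ℝ} (hB : ∀ u y z, |Q u y z| ≤ B) :
    ∫ p, Q p.1 p.2.1 p.2.2 ∂(joinMeasure μ ν) = ∫ ζ, avg μ Q ζ ∂ν := by
  have hm := aemeasurable_map_prod_const hY hZ hμ hmeas hν
  have hJ := joinMeasure_isProbOn hY hZ hμ hm hν
  have := hJ.1
  have := hν.1
  have hmem : ∀ᵐ ζ ∂ν, ζ ∈ Z := hν.2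
  -- Adding `B` makes the integrand nonnegative; the constant cancels because all the measures
  -- involved have mass 1.
  have hQB : Continuous fun p : U × E m × E n => Q p.1 p.2.1 p.2.2 + B := by fun_prop
  have h := integral_joinMeasure_of_nonneg hY hZ hμ hm hν (Q := fun u y z => Q u y z + B) hQB
    (hmeas _ hQB.continuousOn) fun u y z => by linarith [(abs_le.1 (hB u y z)).1]
  have havg : ∀ᵐ ζ ∂ν, avg μ (fun u y z => Q u y z + B) ζ = avg μ Q ζ + B := by
    refine hmem.mono fun ζ hζ => ?_
    have := (hμ ζ hζ).1
    have hQζ : Continuous fun p : U × E m => Q p.1 p.2 ζ :=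
      hQ.comp (continuous_fst.prodMk (continuous_snd.prodMk continuous_const))
    rw [avg, integral_add ((hμ ζ hζ).integrable (isCompact_univ.prod hY) hQζ.continuousOn)
      (integrable_const _)]
    simp [avg]
  have hint : Integrable (avg μ Q) ν := by
    refine Integrable.of_bound (aestronglyMeasurable_avg hZ (hmeas Q hQ.continuousOn) hν) B ?_
    exact hmem.mono fun ζ hζ => (hμ ζ hζ).norm_integral_le fun p _ => hB _ _ _
  rw [integral_congr_ae havg, integral_add hint (integrable_const _),
    integral_add (hJ.integrable (isCompact_univ_prod_prod hY hZ) hQ.continuousOn)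
      (integrable_const _)] at h
  simpa using h

end Join

/-! ### Weak* convergence of the discounted occupational measures -/

lemma integrableOn_discount_mul {C B : ℝ} (hC : 0 < C) {G : ℝ → ℝ}
    (hG : AEStronglyMeasurable G (volume.restrict (Ioi 0))) (hB : ∀ t, 0 ≤ t → |G t| ≤ B) :
    IntegrableOn (fun t => C * Real.exp (-C * t) * G t) (Ioi 0) := by
  have h1 : IntegrableOn (fun t => C * Real.exp (-C * t)) (Ioi 0) :=
    (integrableOn_exp_mul_Ioi (neg_lt_zero.2 hC) 0).const_mul C
  refine Integrable.mul_bdd (c := B) h1 hG ?_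
  filter_upwards [ae_restrict_mem measurableSet_Ioi] with t ht using hB t (le_of_lt ht)

/-- A bounded function with small averages over the steps `[lD, (l+1)D]` has a small discounted
integral. -/
lemma abs_integral_discount_mul_le {C B D η : ℝ} (hC : 0 < C) (hD : 0 < D) (hη : 0 ≤ η)
    {G : ℝ → ℝ} (hG : AEStronglyMeasurable G (volume.restrict (Ioi 0)))
    (hB : ∀ t, 0 ≤ t → |G t| ≤ B)
    (hstep : ∀ l : ℕ, |∫ t in (l * D)..((l + 1) * D), G t| ≤ η * D) :
    |∫ t in Ioi (0 : ℝ), C * Real.exp (-C * t) * G t| ≤ Real.exp (C * D) * (η + B * (C * D)) := by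
  have hB0 : 0 ≤ B := (abs_nonneg _).trans (hB 0 le_rfl)
  have hint := integrableOn_discount_mul hC hG hB
  have hsub : ∀ a b : ℝ, 0 ≤ a → 0 ≤ b → uIoc a b ⊆ Ioi 0 := fun a b ha hb t ht =>
    (le_min ha hb).trans_lt ht.1
  have hiint : ∀ a b : ℝ, 0 ≤ a → 0 ≤ b →
      IntervalIntegrable (fun t => C * Real.exp (-C * t) * G t) volume a b := fun a b ha hb =>
    intervalIntegrable_iff.2 (hint.mono_set (hsub a b ha hb))
  have hGint : ∀ a b : ℝ, 0 ≤ a → 0 ≤ b → IntervalIntegrable G volume a b := by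
    intro a b ha hb
    rw [intervalIntegrable_iff]
    refine IntegrableOn.of_bound (by simp [uIoc])
      (hG.mono_measure (Measure.restrict_mono (hsub a b ha hb) le_rfl)) B ?_
    filter_upwards [ae_restrict_mem measurableSet_uIoc] with t ht
      using hB t (le_of_lt (hsub a b ha hb ht))
  have hA : 0 ≤ η + B * (C * D) := by positivity
  have hcell : ∀ l : ℕ, |∫ t in (l * D)..((l + 1) * D), C * Real.exp (-C * t) * G t| ≤
      Real.exp (C * D) * (η + B * (C * D)) *
        (Real.exp (-C * (l * D)) - Real.exp (-C * ((l + 1) * D))) := by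
    intro l
    have ha : 0 ≤ l * D := by positivity
    have hb : 0 ≤ (l + 1) * D := by positivity
    have hab : l * D ≤ (l + 1) * D := by linarith
    set X := Real.exp (-C * (l * D)) with hX
    have hX0 : 0 < X := Real.exp_pos _
    -- The weight is frozen at the left endpoint, where it equals C X; the remainder is controlled
    -- by the variation of the weight over the step.
    have e1 : ∫ t in (l * D)..((l + 1) * D), C * Real.exp (-C * t) * G t
        = C * X * (∫ t in (l * D)..((l + 1) * D), G t) +
          ∫ t in (l * D)..((l + 1) * D), (C * Real.exp (-C * t) * G t - C * X * G t) := by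
      rw [intervalIntegral.integral_sub (hiint _ _ ha hb) ((hGint _ _ ha hb).const_mul _),
        intervalIntegral.integral_const_mul]
      ring
    have e2 : |∫ t in (l * D)..((l + 1) * D), (C * Real.exp (-C * t) * G t - C * X * G t)|
        ≤ C * (X * (C * D)) * B * D := by
      have := intervalIntegral.norm_integral_le_of_norm_le_const (a := l * D) (b := (l + 1) * D)
        (f := fun t => C * Real.exp (-C * t) * G t - C * X * G t)
        (C := C * (X * (C * D)) * B) fun t ht => ?_
      · have hlen : (l + 1) * D - l * D = D := by ring
        rwa [hlen, abs_of_pos hD] at this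
      rw [uIoc_of_le hab] at ht
      have ht0 : 0 ≤ t := ha.trans ht.1.le
      have hexp : Real.exp (-C * t) = X * Real.exp (-(C * (t - l * D))) := by
        rw [hX, ← Real.exp_add]; ring_nf
      have h1 : 1 - C * (t - l * D) ≤ Real.exp (-(C * (t - l * D))) := by
        linarith [Real.add_one_le_exp (-(C * (t - l * D)))]
      have h0 : 0 ≤ C * (t - l * D) := mul_nonneg hC.le (by linarith [ht.1])
      have h2 : Real.exp (-(C * (t - l * D))) ≤ 1 := Real.exp_le_one_iff.2 (by linarith)
      have h3 : C * (t - l * D) ≤ C * D := mul_le_mul_of_nonneg_left (by linarith [ht.2]) hC.le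
      have h4 : |Real.exp (-C * t) - X| ≤ X * (C * D) := by
        rw [hexp, abs_le]
        constructor <;> nlinarith
      have e3 : C * Real.exp (-C * t) * G t - C * X * G t
          = C * (Real.exp (-C * t) - X) * G t := by ring
      rw [e3, Real.norm_eq_abs, abs_mul, abs_mul, abs_of_pos hC]
      have := hB t ht0
      gcongr
    have e4 : Real.exp (-C * ((l + 1) * D)) * Real.exp (C * D) = X := by
      rw [hX, ← Real.exp_add]; ring_nf
    -- Bounds X·CD by X (e^{CD} - 1), which is e^{CD} times a difference of consecutive
    -- exponentials, so that the sum over steps telescopes.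
    have e5 : C * D + 1 ≤ Real.exp (C * D) := Real.add_one_le_exp _
    have e6 : |C * X * ∫ t in (l * D)..((l + 1) * D), G t| ≤ C * X * (η * D) := by
      rw [abs_mul, abs_of_pos (by positivity)]
      exact mul_le_mul_of_nonneg_left (hstep l) (by positivity)
    calc |∫ t in (l * D)..((l + 1) * D), C * Real.exp (-C * t) * G t|
        ≤ C * X * (η * D) + C * (X * (C * D)) * B * D := by
          rw [e1]; exact (abs_add_le _ _).trans (add_le_add e6 e2)
      _ = (η + B * (C * D)) * (X * (C * D)) := by ring
      _ ≤ (η + B * (C * D)) * (X * (Real.exp (C * D) - 1)) := by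
          gcongr; linarith
      _ = _ := by linear_combination (η + B * (C * D)) * e4
  have hpart : ∀ N : ℕ, |∫ t in (0 : ℝ)..(N * D), C * Real.exp (-C * t) * G t| ≤
      Real.exp (C * D) * (η + B * (C * D)) := by
    intro N
    have hs := intervalIntegral.sum_integral_adjacent_intervals (μ := volume)
      (f := fun t => C * Real.exp (-C * t) * G t) (a := fun l : ℕ => l * D) (n := N)
      fun l _ => hiint _ _ (by positivity) (by positivity)
    simp only [Nat.cast_zero, zero_mul] at hs
    rw [← hs]
    refine (Finset.abs_sum_le_sum_abs _ _).trans ((Finset.sum_le_sum fun l _ => ?_).trans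
      (b := ∑ l ∈ Finset.range N, Real.exp (C * D) * (η + B * (C * D)) *
        (Real.exp (-C * (l * D)) - Real.exp (-C * ((l + 1 : ℕ) * D)))) ?_)
    · push_cast
      exact hcell l
    · rw [← Finset.mul_sum,
        Finset.sum_range_sub' (fun l : ℕ => Real.exp (-C * (l * D))) N]
      refine mul_le_of_le_one_right (by positivity) ?_
      simp only [Nat.cast_zero, zero_mul, mul_zero, Real.exp_zero]
      linarith [Real.exp_pos (-C * (N * D))]
  have hlim := (intervalIntegral_tendsto_integral_Ioi 0 hint
    (tendsto_natCast_atTop_atTop.atTop_mul_const hD)).abs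
  exact le_of_tendsto hlim (Eventually.of_forall hpart)

lemma floor_div_mul_mem {D t : ℝ} (hD : 0 < D) (ht : 0 ≤ t) :
    ⌊t / D⌋₊ * D ≤ t ∧ t ≤ ⌊t / D⌋₊ * D + D := by
  constructor
  · rw [← le_div_iff₀ hD]; exact Nat.floor_le (div_nonneg ht hD.le)
  · have : t ≤ (⌊t / D⌋₊ + 1) * D := by
      rw [← div_le_iff₀ hD]; exact (Nat.lt_floor_add_one _).le
    linarith

/-- Step functions on the time grid are measurable for any `h`, so nothing has to be known about the
values at grid points. -/
lemma measurable_comp_floor_div {F : Type*} [MeasurableSpace F] (h : ℕ → F) (D : ℝ) :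
    Measurable fun t : ℝ => h ⌊t / D⌋₊ :=
  (measurable_of_countable h).comp (Nat.measurable_floor.comp (measurable_id.div_const D))

/-- If `z_ε → z` locally uniformly and `Q̃_μ` is piecewise Lipschitz near `z(·)`, then the
discounted integrals of `Q̃_μ(z_ε(t_l))` converge to that of `Q̃_μ(z(t))`. -/
lemma tendsto_discount_integral_avg {U : Type*} [MeasurableSpace U] {m n : ℕ} {Y : Set (E m)}
    {Z : Set (E n)} {g : U → E m → E n → E n} {z₀ : E n} {Lf : ℝ} {μ : E n → Measure (U × E m)}
    {zε : ℝ → ℝ → E n} (hLf : 0 < Lf)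
    (hμ : ∀ ζ ∈ Z, IsProbOn (univ ×ˢ Y) (μ ζ))
    (hmem : ∀ ε ∈ Ioo (0 : ℝ) 1, ∀ t, 0 ≤ t → zε ε t ∈ Z)
    {z : ℝ → E n} (hz : IsAveragedSolution g μ Z z₀ z)
    (hslow : ∀ T : ℝ, 0 < T → ∀ η : ℝ, 0 < η →
      ∀ᶠ ε in 𝓝[>] 0, ∀ t ∈ Icc 0 T, ‖zε ε t - z t‖ ≤ η)
    {C : ℝ} (hC : 0 < C) {Q : U → E m → E n → ℝ} {B : ℝ} (hB : ∀ u y z, |Q u y z| ≤ B)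
    (hpl : ∀ T : ℝ, 0 < T → ∃ (tb : Finset ℝ) (a : ℝ → ℝ),
      IsPiecewiseLipschitzNear Z z (avg μ Q) T tb a) :
    Tendsto (fun ε => ∫ t in Ioi (0 : ℝ), C * Real.exp (-C * t) *
        avg μ Q (zε ε (⌊t / stepLength Lf ε⌋₊ * stepLength Lf ε))) (𝓝[>] 0)
      (𝓝 (∫ t in Ioi (0 : ℝ), C * Real.exp (-C * t) * avg μ Q (z t))) := by
  have hB' : ∀ ζ ∈ Z, |avg μ Q ζ| ≤ B := fun ζ hζ => by
    rw [← Real.norm_eq_abs]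
    exact (hμ ζ hζ).norm_integral_le fun p _ => hB _ _ _
  have hD0 := tendsto_stepLength hLf
  choose tb a hpl' using fun k : ℕ => hpl (k + 1) (by positivity)
  refine tendsto_integral_filter_of_dominated_convergence
    (fun t => C * Real.exp (-C * t) * B) ?_ ?_ ?_ ?_
  · refine Eventually.of_forall fun ε => ?_
    refine AEStronglyMeasurable.mul (by fun_prop) ?_
    exact (measurable_comp_floor_div (fun l : ℕ => avg μ Q (zε ε (l * stepLength Lf ε)))
      _).aestronglyMeasurable
  · filter_upwards [Ioo_mem_nhdsGT (zero_lt_one' ℝ)] with ε hε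
    have hD := stepLength_pos hLf hε
    refine Eventually.of_forall fun t => ?_
    rw [norm_mul, Real.norm_of_nonneg (by positivity)]
    gcongr
    exact hB' _ (hmem ε hε _ (by positivity))
  · exact ((integrableOn_exp_mul_Ioi (neg_lt_zero.2 hC) 0).const_mul C).mul_const B
  -- Exceptional times depend on the horizon; over the horizons k + 1 they still form a countable
  -- set.
  · have hnull : ∀ᵐ t : ℝ, ∀ k, t ∉ tb k := by
      rw [ae_all_iff]
      intro k
      exact (tb k).countable_toSet.ae_notMem volume
    filter_upwards [ae_restrict_mem measurableSet_Ioi, ae_restrict_of_ae hnull] with t ht hnot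
    have ht0 : (0 : ℝ) < t := ht
    refine Tendsto.const_mul _ ?_
    obtain ⟨k, hk⟩ := exists_nat_ge t
    have htk : t ∈ Icc (0 : ℝ) (k + 1) := ⟨ht0.le, by linarith⟩
    have hpos := (hpl' k).radius_pos t htk (hnot k)
    obtain ⟨L, hL⟩ := (hpl' k).lipschitz
    -- The Lipschitz property on a ball around z(t) is needed only as continuity of Q̃_μ at z(t)
    -- within `Z`.
    have hcont := (hL t htk (hnot k)).continuousOn.continuousWithinAt
      ⟨Metric.mem_ball_self hpos, hz.mem t ht0.le⟩
    have hfloor : Tendsto (fun ε => (⌊t / stepLength Lf ε⌋₊ : ℝ) * stepLength Lf ε) (𝓝[>] 0)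
        (𝓝[Ici 0] t) := by
      refine tendsto_nhdsWithin_iff.2 ⟨?_, ?_⟩
      · refine tendsto_of_tendsto_of_tendsto_of_le_of_le' (g := fun ε => t - stepLength Lf ε)
          (h := fun _ => t) (by simpa using hD0.const_sub t) tendsto_const_nhds ?_ ?_
        all_goals
          filter_upwards [Ioo_mem_nhdsGT (zero_lt_one' ℝ)] with ε hε
          have := floor_div_mul_mem (stepLength_pos hLf hε) ht0.le
          linarith [this.1, this.2]
      · filter_upwards [Ioo_mem_nhdsGT (zero_lt_one' ℝ)] with ε hε
        have := stepLength_pos hLf hε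
        exact mem_Ici.2 (by positivity)
    have hzt : Tendsto (fun ε => z (⌊t / stepLength Lf ε⌋₊ * stepLength Lf ε)) (𝓝[>] 0)
        (𝓝 (z t)) := (hz.ac.continuousOn_Ici t ht0.le).tendsto.comp hfloor
    have hdiff : Tendsto (fun ε => zε ε (⌊t / stepLength Lf ε⌋₊ * stepLength Lf ε) -
        z (⌊t / stepLength Lf ε⌋₊ * stepLength Lf ε)) (𝓝[>] 0) (𝓝 0) := by
      rw [Metric.tendsto_nhds]
      intro η hη
      filter_upwards [hslow t ht0 (η / 2) (by positivity), Ioo_mem_nhdsGT (zero_lt_one' ℝ)]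
        with ε h hε
      have hD := stepLength_pos hLf hε
      rw [dist_zero_right]
      exact (h _ ⟨by positivity, (floor_div_mul_mem hD ht0.le).1⟩).trans_lt (by linarith)
    have hzε : Tendsto (fun ε => zε ε (⌊t / stepLength Lf ε⌋₊ * stepLength Lf ε)) (𝓝[>] 0)
        (𝓝 (z t)) := by
      simpa using hdiff.add hzt
    refine hcont.tendsto.comp (tendsto_nhdsWithin_iff.2 ⟨hzε, ?_⟩)
    filter_upwards [hzε.eventually (Metric.ball_mem_nhds _ hpos),
      Ioo_mem_nhdsGT (zero_lt_one' ℝ)] with ε h hε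
    have hD := stepLength_pos hLf hε
    exact ⟨h, hmem ε hε _ (by positivity)⟩

/-! ### Reduction of weak* convergence to Lipschitz test functions -/

lemma exists_boundedContinuous_eqOn {W : Type*} [MetricSpace W] {K : Set W} (hK : IsCompact K)
    {φ : W → ℝ} (hφ : ContinuousOn φ K) : ∃ ψ : BoundedContinuousFunction W ℝ, EqOn ψ φ K := by
  have := isCompact_iff_compactSpace.1 hK
  obtain ⟨ψ, -, hψ⟩ := BoundedContinuousFunction.exists_norm_eq_domRestrict_eq_of_closed
    (BoundedContinuousFunction.mkOfCompact ⟨K.domRestrict φ, hφ.domRestrict⟩) hK.isClosed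
  exact ⟨ψ, fun w hw => DFunLike.congr_fun hψ ⟨w, hw⟩⟩

/-- Weak* convergence on a compact set may be tested on bounded Lipschitz functions. -/
lemma weakStarTendsto_of_lipschitz {W : Type*} [MetricSpace W] [MeasurableSpace W]
    [OpensMeasurableSpace W] {K : Set W} (hK : IsCompact K) {ν : ℝ → Measure W} {ν₀ : Measure W}
    (hν : ∀ ε ∈ Ioo (0 : ℝ) 1, IsProbOn K (ν ε)) (hν₀ : IsProbOn K ν₀)
    (h : ∀ φ : W → ℝ, (∃ B, ∀ w, |φ w| ≤ B) → (∃ L, LipschitzWith L φ) →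
      Tendsto (fun ε => ∫ w, φ w ∂(ν ε)) (𝓝[>] 0) (𝓝 (∫ w, φ w ∂ν₀))) :
    WeakStarTendsto K ν ν₀ := by
  classical
  set P₀ : ProbabilityMeasure W := ⟨ν₀, hν₀.1⟩ with hP₀
  -- Outside (0, 1) a default value is used, as ν ε need not be a probability measure there.
  set P : ℝ → ProbabilityMeasure W := fun ε =>
    if hε : ε ∈ Ioo (0 : ℝ) 1 then ⟨ν ε, (hν ε hε).1⟩ else P₀ with hP
  have hPε : ∀ᶠ ε in 𝓝[>] 0, (P ε : Measure W) = ν ε := by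
    filter_upwards [Ioo_mem_nhdsGT (zero_lt_one' ℝ)] with ε hε
    have : P ε = ⟨ν ε, (hν ε hε).1⟩ := dif_pos hε
    rw [this]
    rfl
  have hlim : Tendsto P (𝓝[>] 0) (𝓝 P₀) := by
    rw [tendsto_iff_forall_lipschitz_integral_tendsto]
    rintro φ ⟨B, hB⟩ hL
    -- The criterion bounds the oscillation of φ; a bound on |φ| follows by fixing a point.
    have hbd : ∃ B, ∀ w, |φ w| ≤ B := by
      rcases isEmpty_or_nonempty W with hW | ⟨⟨w₀⟩⟩
      · exact ⟨0, fun w => hW.elim w⟩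
      · refine ⟨B + |φ w₀|, fun w => ?_⟩
        have h1 := hB w w₀
        rw [Real.dist_eq] at h1
        have h2 := abs_sub_abs_le_abs_sub (φ w) (φ w₀)
        linarith
    exact (h φ hbd hL).congr' (hPε.mono fun ε hε => by simp only [hε])
  intro φ hφ
  obtain ⟨ψ, hψ⟩ := exists_boundedContinuous_eqOn hK hφ
  have heq : ∀ ν' : Measure W, IsProbOn K ν' → ∫ w, ψ w ∂ν' = ∫ w, φ w ∂ν' := by
    intro ν' hν'
    have hmem : ∀ᵐ w ∂ν', w ∈ K := hν'.2
    exact integral_congr_ae (hmem.mono hψ)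
  rw [← heq ν₀ hν₀]
  refine (ProbabilityMeasure.tendsto_iff_forall_integral_tendsto.1 hlim ψ).congr' ?_
  filter_upwards [hPε, Ioo_mem_nhdsGT (zero_lt_one' ℝ)] with ε h1 hε
  rw [h1, heq _ (hν ε hε)]

section Weak

variable {U : Type*} [MetricSpace U] [CompactSpace U] [MeasurableSpace U] [BorelSpace U]
  {m n : ℕ} {Y : Set (E m)} {Z : Set (E n)} {f : U → E m → E n → E m} {g : U → E m → E n → E n}
  {y₀ : E m} {z₀ : E n} {Lf : ℝ} {μ : E n → Measure (U × E m)} {q : ℕ → U × E m → ℝ}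
  {us : E m → E n → ℝ → U} {ys : E m → E n → ℝ → E m}
  {uε : ℝ → ℝ → U} {yε : ℝ → ℝ → E m} {zε : ℝ → ℝ → E n}

/-- The discounted integral of `Q` along the steered trajectory is asymptotic to that of
`Q̃_μ(z_ε(t_l))`. -/
lemma tendsto_discount_integral_sub
    (hg : Continuous fun p : U × E m × E n => g p.1 p.2.1 p.2.2)
    (hY : IsCompact Y) (hZ : IsCompact Z) (hLf : 0 < Lf) (hfLip : LipschitzInState Y Z f Lf)
    (hμ : ∀ ζ ∈ Z, IsProbOn (univ ×ˢ Y) (μ ζ)) (hq : IsTestSequence (univ ×ˢ Y) q)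
    (hatt : IsUniformlyAttainable f Y Z q μ us ys)
    (htraj : ∀ ε ∈ Ioo (0 : ℝ) 1, IsSteeredTrajectory f g y₀ z₀ us Lf ε (uε ε) (yε ε) (zε ε))
    (hmem : ∀ ε ∈ Ioo (0 : ℝ) 1, ∀ t, 0 ≤ t → yε ε t ∈ Y ∧ zε ε t ∈ Z)
    {C : ℝ} (hC : 0 < C)
    {Q : U → E m → E n → ℝ} (hQ : Continuous fun p : U × E m × E n => Q p.1 p.2.1 p.2.2)
    {B : ℝ} (hB : ∀ u y z, |Q u y z| ≤ B) :
    Tendsto (fun ε => (∫ t in Ioi (0 : ℝ), C * Real.exp (-C * t) * Q (uε ε t) (yε ε t) (zε ε t)) -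
      ∫ t in Ioi (0 : ℝ), C * Real.exp (-C * t) *
        avg μ Q (zε ε (⌊t / stepLength Lf ε⌋₊ * stepLength Lf ε))) (𝓝[>] 0) (𝓝 0) := by
  rw [Metric.tendsto_nhds]
  intro η hη
  have hη' : 0 < η / 4 := by positivity
  have hD0 := tendsto_stepLength hLf
  -- The bound of `abs_integral_discount_mul_le` for tolerance η/4; `B + B` bounds the difference of
  -- Q and its average.
  have hlim : Tendsto (fun ε => Real.exp (C * stepLength Lf ε) *
      (η / 4 + (B + B) * (C * stepLength Lf ε))) (𝓝[>] 0) (𝓝 (η / 4)) := by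
    have h1 := hD0.const_mul C
    have h2 := ((Real.continuous_exp.tendsto _).comp h1).mul
      ((h1.const_mul (B + B)).const_add (η / 4))
    simpa using h2
  filter_upwards [eventually_abs_integral_step_sub_le hg hY hZ hLf hfLip hμ hq hatt htraj hmem hQ
    hη', hlim.eventually_lt_const (show η / 4 < η by linarith), Ioo_mem_nhdsGT (zero_lt_one' ℝ)]
    with ε hstep hlt hε
  have hD := stepLength_pos hLf hε
  have sol := (htraj ε hε).solution
  have hm := hmem ε hε
  generalize stepLength Lf ε = D at *
  have hw := sol.control.aemeasurable_triple sol.ac_fast sol.ac_slow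
  have hQm : AEStronglyMeasurable (fun t => Q (uε ε t) (yε ε t) (zε ε t))
      (volume.restrict (Ioi 0)) :=
    (hQ.measurable.comp_aemeasurable (hw.mono_measure
      (Measure.restrict_mono Ioi_subset_Ici_self le_rfl))).aestronglyMeasurable
  have hHm : AEStronglyMeasurable (fun t : ℝ => avg μ Q (zε ε (⌊t / D⌋₊ * D)))
      (volume.restrict (Ioi 0)) :=
    (measurable_comp_floor_div (fun l : ℕ => avg μ Q (zε ε (l * D))) D).aestronglyMeasurable
  have hHB : ∀ t : ℝ, 0 ≤ t → |avg μ Q (zε ε (⌊t / D⌋₊ * D))| ≤ B := fun t ht => by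
    rw [← Real.norm_eq_abs]
    exact (hμ _ (hm _ (by positivity)).2).norm_integral_le fun p _ => hB _ _ _
  rw [← integral_sub (integrableOn_discount_mul hC hQm fun t _ => hB _ _ _)
    (integrableOn_discount_mul hC hHm hHB), Real.dist_eq, sub_zero]
  simp_rw [← mul_sub]
  refine lt_of_le_of_lt (abs_integral_discount_mul_le hC hD hη'.le (hQm.sub hHm)
    (B := B + B) (fun t ht => (abs_sub _ _).trans (add_le_add (hB _ _ _) (hHB t ht))) fun l => ?_) hlt
  have ht₀ : 0 ≤ l * D := by positivity
  have hle : l * D ≤ (l + 1) * D := by linarith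
  have hcongr : ∫ t in (l * D)..((l + 1) * D), (Q (uε ε t) (yε ε t) (zε ε t) -
      avg μ Q (zε ε (⌊t / D⌋₊ * D))) =
      ∫ t in (l * D)..((l + 1) * D), (Q (uε ε t) (yε ε t) (zε ε t) - avg μ Q (zε ε (l * D))) := by
    refine intervalIntegral.integral_congr_ae ?_
    -- At the right endpoint the floor is already l + 1.
    filter_upwards [Measure.ae_ne volume ((l + 1) * D)] with t ht htI
    rw [uIoc_of_le hle] at htI
    have : ⌊t / D⌋₊ = l := by
      rw [Nat.floor_eq_iff (div_nonneg (ht₀.trans htI.1.le) hD.le), le_div_iff₀ hD,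
        div_lt_iff₀ hD]
      exact ⟨htI.1.le, lt_of_le_of_ne htI.2 ht⟩
    rw [this]
  rw [hcongr, intervalIntegral.integral_sub (intervalIntegrable_comp_of_mem
    (K := univ ×ˢ Y ×ˢ Z) (isCompact_univ_prod_prod hY hZ) hw
    (fun t ht => ⟨mem_univ _, hm t ht⟩) hQ ht₀ (ht₀.trans hle)) intervalIntegrable_const,
    intervalIntegral.integral_const, smul_eq_mul]
  have hlen : (l + 1) * D - l * D = D := by ring
  rw [hlen]
  exact hstep l

end Weak

end SPControl

/-! ### Assembly of the conclusions -/

open SPControl in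
theorem mainTheorem2 {U : Type*} [MetricSpace U] [CompactSpace U] [MeasurableSpace U]
    [BorelSpace U] {m n : ℕ}
    -- the data of the system and the standing assumptions
    (f : U → E m → E n → E m) (g : U → E m → E n → E n)
    (hf : Continuous (fun p : U × E m × E n => f p.1 p.2.1 p.2.2))
    (hg : Continuous (fun p : U × E m × E n => g p.1 p.2.1 p.2.2))
    (Y : Set (E m)) (Z : Set (E n)) (hY : IsCompact Y) (hZ : IsCompact Z)
    (Lf : ℝ) (hLf : 0 < Lf) (hfLip : LipschitzInState Y Z f Lf)
    (hgLip : ∃ Lg : ℝ, LipschitzInState Y Z g Lg)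
    (y₀ : E m) (z₀ : E n) (C : ℝ) (hC : 0 < C)
    (hviable : ∀ ε ∈ Ioo (0 : ℝ) 1, ∀ (u : ℝ → U) (y : ℝ → E m) (z : ℝ → E n),
      IsSPSolution f g y₀ z₀ ε u y z → ∀ t : ℝ, 0 ≤ t → y t ∈ Y ∧ z t ∈ Z)
    -- an ACG family, with its occupational measures and the solution of the averaged equation
    (uz : E n → ℝ → U) (yz : E n → ℝ → E m) (μ : E n → Measure (U × E m)) (z : ℝ → E n)
    (hACG : IsACGFamily f g Y Z z₀ uz yz μ z)
    -- uniform attainability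
    (q : ℕ → U × E m → ℝ) (hq : IsTestSequence (univ ×ˢ Y) q)
    (us : E m → E n → ℝ → U) (ys : E m → E n → ℝ → E m)
    (hatt : IsUniformlyAttainable f Y Z q μ us ys)
    -- weak piecewise Lipschitz continuity near `z(·)`
    (tb : ℝ → Finset ℝ) (a : ℝ → ℝ → ℝ)
    (hwpl : IsWeaklyPiecewiseLipschitz g Y Z μ z tb a)
    -- the constructed controls and the corresponding trajectories
    (uε : ℝ → ℝ → U) (yε : ℝ → ℝ → E m) (zε : ℝ → ℝ → E n)
    (htraj : ∀ ε ∈ Ioo (0 : ℝ) 1,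
      IsSteeredTrajectory f g y₀ z₀ us Lf ε (uε ε) (yε ε) (zε ε))
    -- the tube condition
    (htube : ∀ T : ℝ, 0 < T → ∃ δ : ℝ → ℝ, (∀ ε ∈ Ioo (0 : ℝ) 1, 0 < δ ε) ∧
      Tendsto δ (𝓝[>] 0) (𝓝 0) ∧
      ∀ᶠ ε in 𝓝[>] (0 : ℝ), ∀ t ∈ Icc 0 T, (∀ s ∈ tb T, δ ε ≤ |t - s|) →
        zε ε t ∈ Metric.ball (z t) (a T t)) :
    -- uniform convergence of the slow components on finite intervals
    (∀ T : ℝ, 0 < T → ∃ β : ℝ → ℝ, Tendsto β (𝓝[>] 0) (𝓝 0) ∧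
      ∀ ε ∈ Ioo (0 : ℝ) 1, ∀ t ∈ Icc 0 T, ‖zε ε t - z t‖ ≤ β ε) ∧
    -- the discounted occupational measures and their limit are probability measures on `U × Y × Z`
    (∀ ε ∈ Ioo (0 : ℝ) 1,
      IsProbOn (univ ×ˢ Y ×ˢ Z) (discOccMeasure C (fun t => (uε ε t, yε ε t, zε ε t)))) ∧
    IsProbOn (univ ×ˢ Y ×ˢ Z) (joinMeasure μ (discOccMeasure C z)) ∧
    -- weak* convergence, and convergence in every metric `ρ`
    WeakStarTendsto (univ ×ˢ Y ×ˢ Z)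
      (fun ε => discOccMeasure C (fun t => (uε ε t, yε ε t, zε ε t)))
      (joinMeasure μ (discOccMeasure C z)) ∧
    ∀ Q : ℕ → U × E m × E n → ℝ, IsTestSequence (univ ×ˢ Y ×ˢ Z) Q →
      Tendsto (fun ε => rho Q (discOccMeasure C (fun t => (uε ε t, yε ε t, zε ε t)))
        (joinMeasure μ (discOccMeasure C z))) (𝓝[>] 0) (𝓝 0) := by

  have hμ := hACG.prob
  have hz := hACG.solution
  have hmem : ∀ ε ∈ Ioo (0 : ℝ) 1, ∀ t, 0 ≤ t → yε ε t ∈ Y ∧ zε ε t ∈ Z := fun ε hε =>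
    hviable ε hε _ _ _ (htraj ε hε).solution
  have hslow : ∀ T : ℝ, 0 < T → ∀ η : ℝ, 0 < η →
      ∀ᶠ ε in 𝓝[>] 0, ∀ t ∈ Icc 0 T, ‖zε ε t - z t‖ ≤ η := by
    intro T hT η hη
    obtain ⟨δ, -, hδ, ht⟩ := htube T hT
    exact eventually_norm_slow_sub_le hg hY hZ hLf hfLip hμ hq hatt htraj hmem hz hT
      (hwpl.drift T hT) hδ ht hη
  have hK := isCompact_univ_prod_prod (U := U) hY hZ
  have hw : ∀ ε ∈ Ioo (0 : ℝ) 1,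
      AEMeasurable (fun t => (uε ε t, yε ε t, zε ε t)) (volume.restrict (Ici 0)) := fun ε hε =>
    let sol := (htraj ε hε).solution
    sol.control.aemeasurable_triple sol.ac_fast sol.ac_slow
  have hdisc : ∀ ε ∈ Ioo (0 : ℝ) 1,
      IsProbOn (univ ×ˢ Y ×ˢ Z) (discOccMeasure C (fun t => (uε ε t, yε ε t, zε ε t))) :=
    fun ε hε => discOccMeasure_isProbOn hC hK.measurableSet (hw ε hε) fun t ht =>
      ⟨mem_univ _, hmem ε hε t ht⟩
  have hzm : AEMeasurable z (volume.restrict (Ici 0)) :=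
    hz.ac.continuousOn_Ici.aemeasurable measurableSet_Ici
  have hν : IsProbOn Z (discOccMeasure C z) :=
    discOccMeasure_isProbOn hC hZ.measurableSet hzm hz.mem
  have hjoin := joinMeasure_isProbOn hY hZ hμ
    (aemeasurable_map_prod_const hY hZ hμ hACG.measurable hν) hν
  have hweak : WeakStarTendsto (univ ×ˢ Y ×ˢ Z)
      (fun ε => discOccMeasure C (fun t => (uε ε t, yε ε t, zε ε t)))
      (joinMeasure μ (discOccMeasure C z)) := by
    refine weakStarTendsto_of_lipschitz hK hdisc hjoin fun φ ⟨B, hB⟩ ⟨L, hL⟩ => ?_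
    have hlim₁ := tendsto_discount_integral_sub hg hY hZ hLf hfLip hμ hq hatt htraj hmem hC
      (Q := fun u y z => φ (u, y, z)) hL.continuous fun u y z => hB _
    have hlim₂ := tendsto_discount_integral_avg hLf hμ (fun ε hε t ht => (hmem ε hε t ht).2)
      hz hslow hC (Q := fun u y z => φ (u, y, z)) (fun u y z => hB _)
      (hwpl.observable _ ⟨L, hL.lipschitzOnWith⟩)
    -- The intermediate integral of Q̃_μ(z_ε(t_l)) cancels.
    have hlim := hlim₁.add hlim₂
    simp only [sub_add_cancel, zero_add] at hlim
    have hlimit := integral_joinMeasure hY hZ hμ hACG.measurable hν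
      (Q := fun u y z => φ (u, y, z)) hL.continuous fun u y z => hB _
    rw [integral_discOccMeasure hC hzm (aestronglyMeasurable_avg hZ
      (hACG.measurable _ hL.continuous.continuousOn) hν)] at hlimit
    rw [show ∫ p, φ p ∂(joinMeasure μ (discOccMeasure C z)) = _ from hlimit]
    refine hlim.congr' ?_
    filter_upwards [Ioo_mem_nhdsGT (zero_lt_one' ℝ)] with ε hε
    exact (integral_discOccMeasure hC (hw ε hε) hL.continuous.aestronglyMeasurable).symm
  refine ⟨fun T hT => ?_, hdisc, hjoin, hweak, fun Q hQ =>
    hweak.tendsto_rho (eventually_of_mem (Ioo_mem_nhdsGT zero_lt_one) hdisc) hjoin hQ⟩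
  obtain ⟨R, hR⟩ := hZ.isBounded.exists_norm_le
  have hbdd : ∀ ε ∈ Ioo (0 : ℝ) 1, BddAbove ((fun t => ‖zε ε t - z t‖) '' Icc 0 T) := by
    refine fun ε hε => ⟨R + R, ?_⟩
    rintro _ ⟨t, ht, rfl⟩
    exact (norm_sub_le _ _).trans
      (add_le_add (hR _ (hmem ε hε t ht.1).2) (hR _ (hz.mem t ht.1)))
  -- β is the supremum itself; boundedness of `Z` makes it a genuine bound for every ε in (0, 1),
  -- not only for small ε.
  refine ⟨fun ε => sSup ((fun t => ‖zε ε t - z t‖) '' Icc 0 T), ?_, fun ε hε t ht =>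
    le_csSup (hbdd ε hε) ⟨t, ht, rfl⟩⟩
  rw [Metric.tendsto_nhds]
  intro η hη
  filter_upwards [hslow T hT (η / 2) (by positivity)] with ε h
  have h0 : 0 ≤ sSup ((fun t => ‖zε ε t - z t‖) '' Icc 0 T) :=
    Real.sSup_nonneg (by rintro _ ⟨t, -, rfl⟩; exact norm_nonneg _)
  rw [dist_zero_right, Real.norm_of_nonneg h0]
  refine lt_of_le_of_lt (csSup_le ((nonempty_Icc.2 hT.le).image _) ?_) (half_lt_self hη)
  rintro _ ⟨t, ht, rfl⟩
  exact h t ht
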